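/- For a commutative ring $A$ let $\mathcal V(A)$ be the set of binary cubic forms $f=aX^3+bX^2Y+cXY^2+dY^3$ with $a,b,c,d\in A$, identified with $A^4$, with the action $(Mf)(v)=\det(M)^{-1}f(M^Tv)$ of $\mathrm{GL}_2(A)$. Write $\operatorname{disc}(f)=b^2c^2-4ac^3-4b^3d-27a^2d^2+18abcd$. Fix $r\in\{1,3\}$. Let $\mathcal V^r(\mathbb R)$ be the set of squarefree real binary cubic forms with exactly $r$ roots in $\mathbb P^1(\mathbb R)$, let $\mathcal V^r(\mathbb Z)=\mathcal V(\mathbb Z)\cap\mathcal V^r(\mathbb R)$, and let $\mathcal W^r(\mathbb R)=\{f\in\mathcal V^r(\mathbb R):|\operatorname{disc}(f)|=1\}$. Let $B=\{f\in\mathcal V(\mathbb R): q(f)<1\}$ with $q(f)=5a^2+b^2+c^2+5d^2+2ac+2bd$, and fix $R>0$ such that $R\cdot B\cap\mathcal W^r(\mathbb R)\neq\emptyset$. For $t\in\mathbb R$ and $s>0$ put $n(t)=\begin{pmatrix}1&0\\t&1\end{pmatrix}$ and $a(s)=\begin{pmatrix}s^{-1}&0\\0&s\end{pmatrix}$. For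 $\lambda>0$ put $s_{\min}=\sqrt{\sqrt3/2}$, $s_{\max}=\sqrt[3]{\lambda/2}$, $$(l_1,l_2,l_3,l_4)=(\lambda s^{-3},\sqrt5\lambda s^{-1},\sqrt5\lambda s,\lambda s^3),\qquad l_i'=\lfloor 1+l_i\rfloor,\qquad I'=\prod_{i=1}^4\left[-\tfrac12l_i',\tfrac12l_i'\right),$$ $$(L_1',L_2',L_3',L_4')=(s_{\max}^3+\lambda,\ s_{\max}+\sqrt5\lambda,\ s_{\min}^{-1}+\sqrt5\lambda,\ s_{\min}^{-3}+\lambda).$$ For a real number $T\ge1$ let $\lambda=RT^{1/4}$ and consider the following randomized algorithm (in exact real arithmetic). 1. Pick $t\in(-\frac12,\frac12)$ uniformly at random and, independently, $s\in(s_{\min},\infty)$ with probability measure proportional to $s^{-2}\,d^\times s=s^{-3}\,ds$. 2. Fail unless $\sqrt[4]{1-t^2}<s<s_{\max}$. 3. Fail with probability $1-\frac{l_1'l_2'l_3'l_4'}{L_1'L_2'L_3'L_4'}$. 4. Pick a point $f\in\mathcal V(\mathbb Z)\cap n(t)I'$ uniformly at random, as follows: let $(m'_{ij})$ be the inverse of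 the (lower triangular unipotent) matrix by which $n(t)$ acts on $\mathcal V(\mathbb R)=\mathbb R^4$; for $i=1,\dots,4$ in turn pick $\delta_i\in\{0,\dots,l_i'-1\}$ uniformly at random and let the $i$-th coefficient of $f$ be $v_i=\lceil-\frac12l_i'-\sum_{j<i}m'_{ij}v_j\rceil+\delta_i$. 5. Fail unless $f\in\mathcal V^r(\mathbb R)$, $0<|\operatorname{disc}(f)|\le T$, $f$ is irreducible over $\mathbb Q$, and $f\in R|\operatorname{disc}(f)|^{1/4}\cdot n(t)a(s)B$. 6. Return $f$. Then: (a) For every $T\ge1$ the algorithm either fails or returns a form $f\in\mathcal V^r(\mathbb Z)$ that is irreducible over $\mathbb Q$ and satisfies $0<|\operatorname{disc}(f)|\le T$. (b) For every $T\ge1$ there is a constant $D>0$ (depending on $r,R,T$) such that for every $f\in\mathcal V^r(\mathbb Z)$ that is irreducible over $\mathbb Q$ and satisfies $0<|\operatorname{disc}(f)|\le T$, the group $\mathrm{Stab}_{\mathrm{GL}_2(\mathbb Z)}(f)$ is finite and the probability that the algorithm returns an element of the orbit $\mathrm{GL}_2(\mathbb Z)f$ is $D/\#\mathrm{Stab}_{\mathrm{GL}_2(\mathbb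 Z)}(f)$. (c) There is a constant $p_0>0$, depending only on $r$ and $R$ and not on $T$, such that for every $T\ge1$ for which at least one form as in (b) exists, the algorithm succeeds (does not fail) with probability greater than $p_0$. -/

import Mathlib

open MeasureTheory Set
open scoped ENNReal NNReal Pointwise LinearAlgebra.Projectivization

/-- The binary cubic form `a X³ + b X²Y + c XY² + d Y³`. -/
@[ext]
structure BinaryCubicForm (A : Type*) where
  a : A
  b : A
  c : A
  d : A

namespace BinaryCubicForm

variable {A B : Type*} [CommRing A] [CommRing B]

/-- The coefficient vector `(a, b, c, d)`. -/
def coeffs {A : Type*} (f : BinaryCubicForm A) : Fin 4 → A := ![f.a, f.b, f.c, f.d]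

/-- The form with a given coefficient vector. -/
def ofCoeffs {A : Type*} (v : Fin 4 → A) : BinaryCubicForm A := ⟨v 0, v 1, v 2, v 3⟩

/-- Change of coefficient ring. -/
def map (φ : A →+* B) (f : BinaryCubicForm A) : BinaryCubicForm B :=
  ⟨φ f.a, φ f.b, φ f.c, φ f.d⟩

/-- The value of the form at the vector `v = (x, y)`. -/
def eval (f : BinaryCubicForm A) (v : Fin 2 → A) : A :=
  f.a * v 0 ^ 3 + f.b * v 0 ^ 2 * v 1 + f.c * v 0 * v 1 ^ 2 + f.d * v 1 ^ 3

/-- The form as a polynomial in the two variables `X = X 0` and `Y = X 1`. -/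
noncomputable def toMvPolynomial (f : BinaryCubicForm A) : MvPolynomial (Fin 2) A :=
  MvPolynomial.C f.a * MvPolynomial.X 0 ^ 3
    + MvPolynomial.C f.b * MvPolynomial.X 0 ^ 2 * MvPolynomial.X 1
    + MvPolynomial.C f.c * MvPolynomial.X 0 * MvPolynomial.X 1 ^ 2
    + MvPolynomial.C f.d * MvPolynomial.X 1 ^ 3

/-- The discriminant of a binary cubic form. -/
def disc (f : BinaryCubicForm A) : A :=
  f.b ^ 2 * f.c ^ 2 - 4 * f.a * f.c ^ 3 - 4 * f.b ^ 3 * f.d - 27 * f.a ^ 2 * f.d ^ 2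
    + 18 * f.a * f.b * f.c * f.d

/-- Multiplication of a form by a scalar. -/
instance : SMul A (BinaryCubicForm A) where
  smul x f := ⟨x * f.a, x * f.b, x * f.c, x * f.d⟩

/-- The form `v ↦ f (Mᵀ v)`, that is, `f (M₀₀ X + M₁₀ Y, M₀₁ X + M₁₁ Y)` expanded. -/
def subst (M : Matrix (Fin 2) (Fin 2) A) (f : BinaryCubicForm A) : BinaryCubicForm A where
  a := f.a * M 0 0 ^ 3 + f.b * M 0 0 ^ 2 * M 0 1 + f.c * M 0 0 * M 0 1 ^ 2 + f.d * M 0 1 ^ 3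
  b := 3 * f.a * M 0 0 ^ 2 * M 1 0 + f.b * (M 0 0 ^ 2 * M 1 1 + 2 * M 0 0 * M 1 0 * M 0 1)
    + f.c * (M 1 0 * M 0 1 ^ 2 + 2 * M 0 0 * M 0 1 * M 1 1) + 3 * f.d * M 0 1 ^ 2 * M 1 1
  c := 3 * f.a * M 0 0 * M 1 0 ^ 2 + f.b * (M 1 0 ^ 2 * M 0 1 + 2 * M 0 0 * M 1 0 * M 1 1)
    + f.c * (M 0 0 * M 1 1 ^ 2 + 2 * M 1 0 * M 0 1 * M 1 1) + 3 * f.d * M 0 1 * M 1 1 ^ 2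
  d := f.a * M 1 0 ^ 3 + f.b * M 1 0 ^ 2 * M 1 1 + f.c * M 1 0 * M 1 1 ^ 2 + f.d * M 1 1 ^ 3

/-- The twisted action `(M f)(v) = det(M)⁻¹ f(Mᵀ v)` of `GL₂` on binary cubic forms. -/
instance : MulAction (Matrix.GeneralLinearGroup (Fin 2) A) (BinaryCubicForm A) where
  smul M f := (((Matrix.GeneralLinearGroup.det M)⁻¹ : Aˣ) : A) • subst M.val f
  one_smul f := by
    change (((Matrix.GeneralLinearGroup.det (1 : Matrix.GeneralLinearGroup (Fin 2) A))⁻¹ : Aˣ) : A)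
      • subst (1 : Matrix (Fin 2) (Fin 2) A) f = f
    rw [map_one, inv_one, Units.val_one]
    ext <;> simp [subst, HSMul.hSMul, SMul.smul]
  mul_smul M N f := by
    change (((Matrix.GeneralLinearGroup.det (M * N))⁻¹ : Aˣ) : A) • subst (M.val * N.val) f
      = (((Matrix.GeneralLinearGroup.det M)⁻¹ : Aˣ) : A) • subst M.val
        ((((Matrix.GeneralLinearGroup.det N)⁻¹ : Aˣ) : A) • subst N.val f)
    rw [map_mul, mul_inv, Units.val_mul]
    generalize (((Matrix.GeneralLinearGroup.det M)⁻¹ : Aˣ) : A) = x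
    generalize (((Matrix.GeneralLinearGroup.det N)⁻¹ : Aˣ) : A) = y
    ext <;> simp only [subst, HSMul.hSMul, SMul.smul, Matrix.mul_apply, Fin.sum_univ_two] <;> ring

theorem eval_smul (M : Matrix.GeneralLinearGroup (Fin 2) A) (f : BinaryCubicForm A)
    (v : Fin 2 → A) :
    (M • f).eval v
      = (((Matrix.GeneralLinearGroup.det M)⁻¹ : Aˣ) : A) * f.eval (M.val.transpose.mulVec v) := by
  change eval ((((Matrix.GeneralLinearGroup.det M)⁻¹ : Aˣ) : A) • subst M.val f) v = _
  generalize (((Matrix.GeneralLinearGroup.det M)⁻¹ : Aˣ) : A) = x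
  simp only [eval, subst, HSMul.hSMul, SMul.smul, Matrix.mulVec, dotProduct, Fin.sum_univ_two,
    Matrix.transpose_apply]
  ring

/-- An integral form viewed as a real form. -/
noncomputable def toReal (f : BinaryCubicForm ℤ) : BinaryCubicForm ℝ := f.map (Int.castRingHom ℝ)

/-- Irreducibility over `ℚ` of an integral form. -/
def IrreducibleOverRat (f : BinaryCubicForm ℤ) : Prop :=
  Irreducible (f.map (Int.castRingHom ℚ)).toMvPolynomial

/-- The set of squarefree real binary cubic forms with exactly `r` roots in `ℙ¹(ℝ)`. -/
def signatureSet (r : ℕ) : Set (BinaryCubicForm ℝ) :=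
  {f | Squarefree f.toMvPolynomial ∧ {p : ℙ ℝ (Fin 2 → ℝ) | f.eval p.rep = 0}.ncard = r}

/-- The forms in `signatureSet r` of discriminant `±1`. -/
def unitDiscSet (r : ℕ) : Set (BinaryCubicForm ℝ) :=
  {f | f ∈ signatureSet r ∧ |f.disc| = 1}

/-- The `O₂(ℝ)`-invariant quadratic form `q`. -/
def q (f : BinaryCubicForm ℝ) : ℝ :=
  5 * f.a ^ 2 + f.b ^ 2 + f.c ^ 2 + 5 * f.d ^ 2 + 2 * f.a * f.c + 2 * f.b * f.d

/-- The open unit ball for the norm `√q`. -/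
def unitBall : Set (BinaryCubicForm ℝ) := {f | √(q f) < 1}

/-- The forms whose orbits are to be sampled: irreducible over `ℚ`, squarefree with `r` real roots,
and `0 < |disc f| ≤ T`. -/
def IsTarget (r : ℕ) (T : ℝ) (f : BinaryCubicForm ℤ) : Prop :=
  f.IrreducibleOverRat ∧ f.toReal ∈ signatureSet r ∧ 0 < |f.toReal.disc| ∧ |f.toReal.disc| ≤ T

end BinaryCubicForm

namespace CubicSampling

open BinaryCubicForm

/-- The lower unipotent matrix `n(t)`. -/
noncomputable def nMat (t : ℝ) : Matrix.GeneralLinearGroup (Fin 2) ℝ :=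
  Matrix.GeneralLinearGroup.mkOfDetNeZero !![1, 0; t, 1] (by simp)

open Classical in
/-- The diagonal matrix `a(s) = diag(s⁻¹, s)` (with the junk value `1` at `s = 0`). -/
noncomputable def aMat (s : ℝ) : Matrix.GeneralLinearGroup (Fin 2) ℝ :=
  if hs : s ≠ 0 then
    Matrix.GeneralLinearGroup.mkOfDetNeZero !![s⁻¹, 0; 0, s] (by simp [hs])
  else 1

/-- The matrix by which `n(t)` acts on coefficient vectors. -/
def nAct (t : ℝ) : Matrix (Fin 4) (Fin 4) ℝ :=
  !![1, 0, 0, 0; 3 * t, 1, 0, 0; 3 * t ^ 2, 2 * t, 1, 0; t ^ 3, t ^ 2, t, 1]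

theorem coeffs_nMat_smul (t : ℝ) (f : BinaryCubicForm ℝ) :
    (nMat t • f).coeffs = (nAct t).mulVec f.coeffs := by
  have h : nMat t • f = subst !![1, 0; t, 1] f := by
    change (((Matrix.GeneralLinearGroup.det (nMat t))⁻¹ : ℝˣ) : ℝ) • subst !![1, 0; t, 1] f = _
    have hd : Matrix.GeneralLinearGroup.det (nMat t) = 1 := by
      ext
      simp [nMat, Matrix.GeneralLinearGroup.mkOfDetNeZero]
    rw [hd, inv_one, Units.val_one]
    ext <;> simp [HSMul.hSMul, SMul.smul]
  rw [h]
  ext i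
  fin_cases i <;>
    simp [coeffs, subst, nAct, Matrix.mulVec, dotProduct, Fin.sum_univ_four] <;> ring

/-- The number `s_min = √(√3 / 2)`. -/
noncomputable def sMin : ℝ := √(√3 / 2)

/-- The number `s_max = ∛(lam / 2)`. -/
noncomputable def sMax (lam : ℝ) : ℝ := (lam / 2) ^ (1 / 3 : ℝ)

/-- The side lengths `l_i(lam, s)` of the box `lam · a(s) I`. -/
noncomputable def side (lam s : ℝ) : Fin 4 → ℝ :=
  ![lam * (s ^ 3)⁻¹, √5 * lam * s⁻¹, √5 * lam * s, lam * s ^ 3]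

/-- The integer side lengths `l_i'(lam, s) = ⌊1 + l_i(lam, s)⌋`. -/
noncomputable def intSide (lam s : ℝ) (i : Fin 4) : ℕ := ⌊1 + side lam s i⌋₊

/-- The constants `L_i'(lam)`. -/
noncomputable def boundSide (lam : ℝ) : Fin 4 → ℝ :=
  ![sMax lam ^ 3 + lam, sMax lam + √5 * lam, sMin⁻¹ + √5 * lam, (sMin ^ 3)⁻¹ + lam]

/-- A uniformly random element of `{0, …, l - 1}` (with the junk value `0` if `l = 0`). -/
noncomputable def uniformBelow (l : ℕ) : PMF ℕ :=
  if h : l = 0 then PMF.pure 0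
  else PMF.uniformOfFinset (Finset.range l) (Finset.nonempty_range_iff.mpr h)

/-- A coin that shows `true` with probability `p` (with probability `1` if `p > 1`). -/
noncomputable def coin (p : ℝ≥0) : PMF Bool :=
  PMF.ofFintype (fun b => cond b (min p 1 : ℝ≥0) (1 - min p 1 : ℝ≥0)) (by
    rw [Fintype.sum_bool, cond_true, cond_false, ← ENNReal.coe_add,
      add_tsub_cancel_of_le (min_le_right p 1), ENNReal.coe_one])

/-- Random lattice point of `M I`, where `I` is the product of the intervals `[x_i, x_i + l_i)`
and `M` is a lower triangular unipotent matrix: for `i = 1, …, n` in turn, pick `δ` uniformly from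
`{0, …, l_i - 1}` and put `v_i = ⌈x_i - ∑_{j < i} m'_{ij} v_j⌉ + δ`, where `M⁻¹ = (m'_{ij})`. -/
noncomputable def samplePoint {n : ℕ} (x : Fin n → ℝ) (l : Fin n → ℕ)
    (M : Matrix (Fin n) (Fin n) ℝ) : PMF (Fin n → ℤ) :=
  (List.finRange n).foldlM (fun v i => do
    let δ ← uniformBelow (l i)
    pure (Function.update v i (⌈x i - ∑ j with j < i, M⁻¹ i j * v j⌉ + δ))) 0

open Classical in
/-- The sampling algorithm with parameters `r`, `R`, `T` after the real numbers `t` and `s` have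
been drawn; `none` stands for failure. -/
noncomputable def runAt (r : ℕ) (R T t s : ℝ) : PMF (Option (BinaryCubicForm ℤ)) :=
  let lam := R * T ^ (1 / 4 : ℝ)
  if (1 - t ^ 2) ^ (1 / 4 : ℝ) < s ∧ s < sMax lam then do
    let go ← coin (((∏ i, (intSide lam s i : ℝ)) / ∏ i, boundSide lam i).toNNReal)
    if go = true then do
      let v ← samplePoint (fun i => -(1 / 2) * (intSide lam s i : ℝ)) (intSide lam s) (nAct t)
      let f := ofCoeffs v
      if f.toReal ∈ signatureSet r ∧ (0 < |f.toReal.disc| ∧ |f.toReal.disc| ≤ T) ∧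
          f.IrreducibleOverRat ∧
          f.toReal ∈ (R * |f.toReal.disc| ^ (1 / 4 : ℝ)) • (nMat t * aMat s) • unitBall then
        pure (some f)
      else pure none
    else pure none
  else pure none

/-- The uniform distribution on `(-1/2, 1/2)`. -/
noncomputable def tLaw : Measure ℝ := ProbabilityTheory.cond volume (Ioo (-1 / 2) (1 / 2))

/-- The measure `s⁻² d×s = s⁻³ ds` on `(s_min, ∞)`. -/
noncomputable def sMeasure : Measure ℝ :=
  (volume.restrict (Ioi sMin)).withDensity fun s => ENNReal.ofReal ((s ^ 3)⁻¹)

/-- The probability measure on `(s_min, ∞)` proportional to `s⁻² d×s`. -/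
noncomputable def sLaw : Measure ℝ := (sMeasure univ)⁻¹ • sMeasure

/-- The countable set of possible outputs carries the discrete `σ`-algebra. -/
instance : MeasurableSpace (Option (BinaryCubicForm ℤ)) := ⊤

/-- The distribution of the output of the sampling algorithm: `t` and `s` are drawn independently
from `tLaw` and `sLaw`, and then the remaining steps are carried out. -/
noncomputable def outputLaw (r : ℕ) (R T : ℝ) : Measure (Option (BinaryCubicForm ℤ)) :=
  (tLaw.prod sLaw).bind fun p => (runAt r R T p.1 p.2).toMeasure

end CubicSampling

/-!
The matrix `n(t) a(s)` moves `i` to the point `t + i s²` of the upper half-plane, and the last test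
of the algorithm says that this point lies in an open set `L(f)` which depends on `f` equivariantly.
The first two steps confine the point to the interior `𝒟ᵒ` of the standard fundamental domain, where
it is distributed by a multiple of hyperbolic area, since `dt ds / s³ = ½ dx dy / y²`. The box
`n(t) I'` contains every form that could pass the last test, and the rejection step cancels the
dependence of the number of its lattice points on `s`. Hence a target form `f` is returned with
probability proportional to the area of `𝒟ᵒ ∩ L(f)`.

Summed over the orbit of `f`, these areas unfold to `4 · area(L(f)) / #Stab(f)`: two elements of
`GL₂(ℤ)` act trivially on `ℍ`, and `SL₂(ℤ)` has index two. Real forms whose discriminants have the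
same sign are equivalent under `GL₂(ℝ)`, so that `area(L(f))` does not depend on `f`.

The success probability is bounded below in two ranges of `T`. For bounded `T`, the orbit of a
single target form suffices, a stabilizer having at most `6` elements. For large `T`, the box of
volume of order `T` contains at least a constant times `T` integral forms which are congruent to
the irreducible form `X³ + XY² + Y³` modulo `2`, and whose sets `L(f)` share an open subset of `𝒟ᵒ`.
-/

/-! ### Binary cubic forms under linear substitutions -/

open MvPolynomial in
theorem irreducible_of_irreducible_aeval {σ K : Type*} [Field K] {g : σ → Polynomial K}
    (hg : ∀ i, (g i).natDegree ≤ 1) {F : MvPolynomial σ K}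
    (hF : F.totalDegree ≤ (aeval g F).natDegree) (h : Irreducible (aeval g F)) :
    Irreducible F := by
  have isUnit_left {G H : MvPolynomial σ K} (hGH : F = G * H) (hG : IsUnit (aeval g G)) :
      IsUnit G := by
    have hF0 : aeval g (G * H) ≠ 0 := hGH ▸ h.ne_zero
    have hG0 : G ≠ 0 := by rintro rfl; simp at hF0
    have hH0 : H ≠ 0 := by rintro rfl; simp at hF0
    have hdeg : G.totalDegree + H.totalDegree ≤ (aeval g H).natDegree := by
      rw [map_mul] at hF0
      rwa [hGH, totalDegree_mul_of_isDomain hG0 hH0, map_mul,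
        Polynomial.natDegree_mul (left_ne_zero_of_mul hF0) (right_ne_zero_of_mul hF0),
        Polynomial.natDegree_eq_zero_of_isUnit hG, zero_add] at hF
    have hle : (aeval g H).natDegree ≤ H.totalDegree := by
      simpa using aeval_natDegree_le H le_rfl g hg
    obtain ⟨c, rfl⟩ : ∃ c, G = C c := ⟨_, totalDegree_eq_zero_iff_eq_C.1 (by omega)⟩
    exact (IsUnit.mk0 c fun hc => hG0 (by rw [hc, map_zero])).map C
  refine ⟨fun hF => h.not_isUnit (hF.map (aeval g)), fun G H hGH => ?_⟩
  rcases h.isUnit_or_isUnit (show aeval g F = aeval g G * aeval g H by rw [hGH, map_mul]) with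
    hG | hH
  · exact .inl (isUnit_left hGH hG)
  · exact .inr (isUnit_left (hGH.trans (mul_comm G H)) hH)

namespace BinaryCubicForm

section Action

variable {A B : Type*} [CommRing A] [CommRing B]

theorem smul_def (x : A) (f : BinaryCubicForm A) :
    x • f = ⟨x * f.a, x * f.b, x * f.c, x * f.d⟩ := rfl

theorem gl_smul_def (M : GL (Fin 2) A) (f : BinaryCubicForm A) :
    M • f = (((Matrix.GeneralLinearGroup.det M)⁻¹ : Aˣ) : A) • subst M.val f := rfl

theorem inv_det_mul_det (M : GL (Fin 2) A) :
    (((Matrix.GeneralLinearGroup.det M)⁻¹ : Aˣ) : A) * M.val.det = 1 :=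
  Units.inv_mul (Matrix.GeneralLinearGroup.det M)

theorem gl_smul_eq_iff {M : GL (Fin 2) A} {f g : BinaryCubicForm A} :
    M • f = g ↔ subst M.val f = M.val.det • g := by
  have h := inv_det_mul_det M
  constructor
  · rintro rfl
    ext <;> simp only [gl_smul_def, smul_def, ← mul_assoc, (mul_comm _ _).trans h, one_mul]
  · intro hM
    ext <;> simp only [gl_smul_def, hM, smul_def, ← mul_assoc, h, one_mul]

theorem disc_smul (x : A) (f : BinaryCubicForm A) : (x • f).disc = x ^ 4 * f.disc := by
  simp only [disc, smul_def]
  ring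

theorem disc_subst (M : Matrix (Fin 2) (Fin 2) A) (f : BinaryCubicForm A) :
    (subst M f).disc = M.det ^ 6 * f.disc := by
  simp only [disc, subst, Matrix.det_fin_two]
  ring

theorem disc_gl_smul (M : GL (Fin 2) A) (f : BinaryCubicForm A) :
    (M • f).disc = M.val.det ^ 2 * f.disc := by
  rw [gl_smul_def, disc_smul, disc_subst]
  linear_combination
    (M.val.det ^ 2 * f.disc) * congrArg (· ^ 4) (inv_det_mul_det M)

theorem gl_smul_smul_comm (x : A) (M : GL (Fin 2) A) (f : BinaryCubicForm A) :
    M • x • f = x • M • f := by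
  simp only [gl_smul_def]
  ext <;> simp only [smul_def, subst] <;> ring

theorem eval_smul_vec (f : BinaryCubicForm A) (x : A) (v : Fin 2 → A) :
    f.eval (x • v) = x ^ 3 * f.eval v := by
  simp only [eval, Pi.smul_apply, smul_eq_mul]
  ring

theorem eval_map (φ : A →+* B) (f : BinaryCubicForm A) (v : Fin 2 → A) :
    (f.map φ).eval (φ ∘ v) = φ (f.eval v) := by
  simp [eval, map]

theorem disc_map (φ : A →+* B) (f : BinaryCubicForm A) : (f.map φ).disc = φ f.disc := by
  simp only [disc, map, map_sub, map_add, map_mul, map_pow, map_ofNat]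

theorem map_gl_smul (φ : A →+* B) (M : GL (Fin 2) A) (f : BinaryCubicForm A) :
    (M • f).map φ = Matrix.GeneralLinearGroup.map φ M • f.map φ := by
  have h : φ ((((Matrix.GeneralLinearGroup.det M)⁻¹ : Aˣ) : A))
      = (((Matrix.GeneralLinearGroup.det (Matrix.GeneralLinearGroup.map φ M))⁻¹ : Bˣ) : B) := by
    rw [Matrix.GeneralLinearGroup.map_det, ← map_inv]
    rfl
  rw [gl_smul_def, gl_smul_def, ← h]
  ext <;> simp only [map, smul_def, subst, Matrix.GeneralLinearGroup.map_apply, map_mul, map_add,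
    map_pow, map_ofNat]

end Action

section Polynomial

open MvPolynomial

variable {A : Type*} [CommRing A]

/-- The substitution of variables `X ↦ M₀₀ X + M₁₀ Y`, `Y ↦ M₀₁ X + M₁₁ Y` by which `subst M` acts
on polynomials. -/
noncomputable def substHom (M : Matrix (Fin 2) (Fin 2) A) :
    MvPolynomial (Fin 2) A →ₐ[A] MvPolynomial (Fin 2) A :=
  aeval fun j => C (M 0 j) * X 0 + C (M 1 j) * X 1

theorem substHom_one : substHom (1 : Matrix (Fin 2) (Fin 2) A) = AlgHom.id A _ := by
  ext j : 1
  fin_cases j <;> simp [substHom]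

theorem substHom_mul (M N : Matrix (Fin 2) (Fin 2) A) :
    substHom (M * N) = (substHom M).comp (substHom N) := by
  ext j : 1
  simp only [substHom, aeval_X, AlgHom.comp_apply, map_add, map_mul, algHom_C, algebraMap_eq,
    Matrix.mul_apply, Fin.sum_univ_two]
  ring

/-- The automorphism of the polynomial ring given by the substitution `substHom M`, for an
invertible matrix `M`. -/
noncomputable def substEquiv (M : GL (Fin 2) A) :
    MvPolynomial (Fin 2) A ≃ₐ[A] MvPolynomial (Fin 2) A :=
  AlgEquiv.ofAlgHom (substHom M.val) (substHom M⁻¹.val)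
    (by rw [← substHom_mul, Units.mul_inv, substHom_one])
    (by rw [← substHom_mul, Units.inv_mul, substHom_one])

theorem toMvPolynomial_smul (x : A) (f : BinaryCubicForm A) :
    (x • f).toMvPolynomial = C x * f.toMvPolynomial := by
  simp only [toMvPolynomial, smul_def, map_mul]
  ring

theorem toMvPolynomial_subst (M : Matrix (Fin 2) (Fin 2) A) (f : BinaryCubicForm A) :
    (subst M f).toMvPolynomial = substHom M f.toMvPolynomial := by
  simp only [toMvPolynomial, subst, substHom, map_add, map_mul, map_pow, aeval_X, algHom_C,
    algebraMap_eq, map_ofNat]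
  ring

theorem associated_substEquiv_toMvPolynomial (M : GL (Fin 2) A) (f : BinaryCubicForm A) :
    Associated (substEquiv M f.toMvPolynomial) (M • f).toMvPolynomial := by
  rw [gl_smul_def, toMvPolynomial_smul, toMvPolynomial_subst]
  exact associated_unit_mul_right _ _ ((Matrix.GeneralLinearGroup.det M)⁻¹.isUnit.map C)

theorem irreducible_toMvPolynomial_gl_smul_iff (M : GL (Fin 2) A) (f : BinaryCubicForm A) :
    Irreducible (M • f).toMvPolynomial ↔ Irreducible f.toMvPolynomial := by
  rw [← (associated_substEquiv_toMvPolynomial M f).irreducible_iff, MulEquiv.irreducible_iff]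

theorem dvd_disc_mul_X_pow {f : BinaryCubicForm A} {p : MvPolynomial (Fin 2) A}
    (hp : ∀ i, p ∣ pderiv i f.toMvPolynomial) (i : Fin 2) : p ∣ C (3 * f.disc) * X i ^ 3 := by
  have hX : pderiv 0 f.toMvPolynomial
      = C (3 * f.a) * X 0 ^ 2 + C (2 * f.b) * X 0 * X 1 + C f.c * X 1 ^ 2 := by
    simp only [map_mul, map_ofNat]
    simp [toMvPolynomial, pderiv_X]
    ring
  have hY : pderiv 1 f.toMvPolynomial
      = C f.b * X 0 ^ 2 + C (2 * f.c) * X 0 * X 1 + C (3 * f.d) * X 1 ^ 2 := by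
    simp only [map_mul, map_ofNat]
    simp [toMvPolynomial, pderiv_X]
    ring
  have combine {g u v : MvPolynomial (Fin 2) A}
      (h : g = pderiv 0 f.toMvPolynomial * u - pderiv 1 f.toMvPolynomial * v) : p ∣ g :=
    h ▸ dvd_sub ((hp 0).mul_right u) ((hp 1).mul_right v)
  let δ : MvPolynomial (Fin 2) A := C (9 * f.a * f.d - f.b * f.c)
  fin_cases i
  · let ε : MvPolynomial (Fin 2) A := C (6 * f.b * f.d - 2 * f.c ^ 2)
    refine combine (u := ε * (X 1 * C (3 * f.d) + X 0 * C (2 * f.c)) - δ * X 0 * C (3 * f.d))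
      (v := ε * (X 1 * C f.c + X 0 * C (2 * f.b)) - δ * X 0 * C f.c) ?_
    simp only [hX, hY, δ, ε, disc, Fin.zero_eta, map_mul, map_add, map_sub, map_pow, map_ofNat]
    ring
  · let ε : MvPolynomial (Fin 2) A := C (6 * f.a * f.c - 2 * f.b ^ 2)
    refine combine (u := δ * X 1 * C f.b - ε * (X 0 * C f.b + X 1 * C (2 * f.c)))
      (v := δ * X 1 * C (3 * f.a) - ε * (X 0 * C (3 * f.a) + X 1 * C (2 * f.b))) ?_
    simp only [hX, hY, δ, ε, disc, Fin.mk_one, map_mul, map_add, map_sub, map_pow, map_ofNat]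
    ring

variable {K : Type*} [Field K] {f : BinaryCubicForm K}

theorem squarefree_toMvPolynomial [NeZero (3 : K)] (hf : f.disc ≠ 0) :
    Squarefree f.toMvPolynomial := by
  rintro p ⟨k, hk⟩
  have hp (i : Fin 2) : p ∣ pderiv i f.toMvPolynomial := by
    rw [hk]
    simp only [Derivation.leibniz, smul_eq_mul]
    exact ⟨p * pderiv i k + 2 * k * pderiv i p, by ring⟩
  have hdisc : IsUnit (C (σ := Fin 2) (3 * f.disc)) :=
    (IsUnit.mk0 _ (mul_ne_zero three_ne_zero hf)).map C
  have hX (i : Fin 2) : p ∣ X i ^ 3 := hdisc.dvd_mul_left.1 (dvd_disc_mul_X_pow hp i)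
  have hrel : IsRelPrime (X 0 : MvPolynomial (Fin 2) K) (X 1) := by
    rw [X_prime.irreducible.isRelPrime_iff_not_dvd]
    intro h
    simpa using map_dvd (MvPolynomial.eval ![(0 : K), 1]) h
  exact hrel.pow (hX 0) (hX 1)

theorem a_ne_zero_of_irreducible (hf : Irreducible f.toMvPolynomial) : f.a ≠ 0 := by
  intro ha
  have hfac : f.toMvPolynomial
      = X 1 * (C f.b * X 0 ^ 2 + C f.c * X 0 * X 1 + C f.d * X 1 ^ 2) := by
    simp only [toMvPolynomial, ha, map_zero]
    ring
  rcases hf.isUnit_or_isUnit hfac with h | h <;>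
    simpa using h.map (constantCoeff (R := K) (σ := Fin 2))

theorem isHomogeneous_toMvPolynomial (f : BinaryCubicForm A) :
    f.toMvPolynomial.IsHomogeneous 3 := by
  refine .add (.add (.add ?_ ?_) ?_) ?_
  · exact (isHomogeneous_X_pow 0 3).C_mul _
  · exact ((isHomogeneous_X_pow 0 2).C_mul _).mul (isHomogeneous_X A 1)
  · exact ((isHomogeneous_X A 0).C_mul _).mul (isHomogeneous_X_pow 1 2)
  · exact (isHomogeneous_X_pow 1 3).C_mul _

/-- The dehomogenization `f(X, 1)` of a binary cubic form. -/
def toCubic (f : BinaryCubicForm A) : Cubic A := ⟨f.a, f.b, f.c, f.d⟩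

theorem aeval_toMvPolynomial (f : BinaryCubicForm A) :
    aeval ![Polynomial.X, 1] f.toMvPolynomial = f.toCubic.toPoly := by
  simp [toMvPolynomial, toCubic, Cubic.toPoly]

theorem natDegree_toPoly (hf : ∀ v ≠ 0, f.eval v ≠ 0) : f.toCubic.toPoly.natDegree = 3 :=
  Cubic.natDegree_of_a_ne_zero (by simpa [eval, toCubic] using hf ![1, 0] (by simp))

theorem irreducible_toPoly (hf : ∀ v ≠ 0, f.eval v ≠ 0) : Irreducible f.toCubic.toPoly := by
  refine Polynomial.irreducible_of_degree_le_three_of_not_isRoot (by simp [natDegree_toPoly hf])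
    fun x hx => hf ![x, 1] (by simp) ?_
  simpa [toCubic, Cubic.toPoly, eval, Polynomial.IsRoot] using hx

theorem irreducible_toMvPolynomial (hf : ∀ v ≠ 0, f.eval v ≠ 0) :
    Irreducible f.toMvPolynomial := by
  apply irreducible_of_irreducible_aeval (g := ![Polynomial.X, 1])
  · intro i
    fin_cases i <;> simp
  · rw [aeval_toMvPolynomial, natDegree_toPoly hf]
    exact (isHomogeneous_toMvPolynomial f).totalDegree_le
  · rw [aeval_toMvPolynomial]
    exact irreducible_toPoly hf

theorem exists_eval_eq_zero_of_real (f : BinaryCubicForm ℝ) : ∃ v ≠ 0, f.eval v = 0 := by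
  by_contra! h
  have := (irreducible_toPoly h).natDegree_le_two
  have := natDegree_toPoly h
  omega

theorem exists_eval_eq_zero_of_isAlgClosed [IsAlgClosed K] (f : BinaryCubicForm K) :
    ∃ v ≠ 0, f.eval v = 0 := by
  by_contra! h
  have h1 := Polynomial.natDegree_eq_of_degree_eq_some
    (IsAlgClosed.degree_eq_one_of_irreducible K (irreducible_toPoly h))
  exact absurd ((natDegree_toPoly h).symm.trans h1) (by norm_num)

end Polynomial

end BinaryCubicForm

/-! ### Stabilizers -/

namespace BinaryCubicForm

section NormalForm

variable {K : Type*} [Field K] {f : BinaryCubicForm K}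

/-- The form `X²Y + ε Y³`; over a field of characteristic other than `2` every form of nonzero
discriminant with a root in `ℙ¹` is equivalent to such a form. -/
def normalForm (ε : K) : BinaryCubicForm K := ⟨0, 1, 0, ε⟩

theorem disc_normalForm (ε : K) : (normalForm ε).disc = -4 * ε := by
  simp [disc, normalForm]

theorem exists_gl_smul_a_eq_zero {v : Fin 2 → K} (hv : v ≠ 0) (h : f.eval v = 0) :
    ∃ M : GL (Fin 2) K, (M • f).a = 0 := by
  obtain ⟨w, hw⟩ : ∃ w : Fin 2 → K, (Matrix.of ![v, w]).det ≠ 0 := by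
    by_cases h0 : v 0 = 0
    · have h1 : v 1 ≠ 0 := fun h1 => hv (by ext i; fin_cases i <;> simp [h0, h1])
      exact ⟨![1, 0], by simp [Matrix.det_fin_two, h1]⟩
    · exact ⟨![0, 1], by simp [Matrix.det_fin_two, h0]⟩
  refine ⟨Matrix.GeneralLinearGroup.mkOfDetNeZero _ hw, ?_⟩
  have hv' : (Matrix.of ![v, w]).transpose.mulVec ![1, 0] = v := by
    ext i
    simp [Matrix.mulVec, dotProduct]
  calc _ = (Matrix.GeneralLinearGroup.mkOfDetNeZero _ hw • f).eval ![1, 0] := by simp [eval]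
    _ = 0 := by
      rw [eval_smul]
      exact mul_eq_zero_of_right _ ((congrArg f.eval hv').trans h)

theorem exists_gl_smul_eq_normalForm [NeZero (2 : K)] (hf : f.disc ≠ 0) {v : Fin 2 → K}
    (hv : v ≠ 0) (h : f.eval v = 0) : ∃ (M : GL (Fin 2) K) (ε : K), M • f = normalForm ε := by
  obtain ⟨M, hM⟩ := exists_gl_smul_a_eq_zero hv h
  have hd : (M • f).disc ≠ 0 := by
    rw [disc_gl_smul]
    exact mul_ne_zero (pow_ne_zero _ M.det_ne_zero) hf
  generalize hg : M • f = g at hM hd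
  obtain ⟨a, b, c, d⟩ := g
  obtain rfl : a = 0 := hM
  have hb : b ≠ 0 := by
    rintro rfl
    simp [disc] at hd
  let N : GL (Fin 2) K := Matrix.GeneralLinearGroup.mkOfDetNeZero
    !![b⁻¹, 0; -c / (2 * b), 1] (by simp [hb])
  refine ⟨N * M, b * d - c ^ 2 / 4, ?_⟩
  have h2 : (2 : K) ≠ 0 := two_ne_zero
  have h4 : (4 : K) ≠ 0 := by simpa [show (4 : K) = 2 * 2 by norm_num] using h2
  have hN : N.val = !![b⁻¹, 0; -c / (2 * b), 1] := rfl
  rw [mul_smul, hg, gl_smul_eq_iff, hN, Matrix.det_fin_two]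
  ext <;> simp [subst, smul_def, normalForm] <;> field_simp <;> ring

theorem exists_gl_smul_normalForm_eq {ρ : K} (hρ : ρ ≠ 0) (ε : K) :
    ∃ M : GL (Fin 2) K, M • normalForm ε = normalForm (ε / ρ ^ 2) := by
  refine ⟨.mkOfDetNeZero !![1, 0; 0, ρ⁻¹] (by simp [hρ]), ?_⟩
  rw [gl_smul_eq_iff]
  ext <;> simp [subst, smul_def, normalForm, Matrix.GeneralLinearGroup.mkOfDetNeZero]
  field_simp

end NormalForm

section Stabilizer

variable {K : Type*} [Field K]

/-- The form `X³ + Y³`, to which every form of nonzero discriminant is equivalent over an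
algebraically closed field of characteristic other than `2` and `3`. -/
def sumOfCubes (K : Type*) [Field K] : BinaryCubicForm K := ⟨1, 0, 0, 1⟩

theorem exists_gl_smul_sumOfCubes_eq_normalForm [IsAlgClosed K] [NeZero (2 : K)] [NeZero (3 : K)]
    {ε : K} (hε : ε ≠ 0) : ∃ M : GL (Fin 2) K, M • sumOfCubes K = normalForm ε := by
  have h2 : (2 : K) ≠ 0 := two_ne_zero
  have h3 : (3 : K) ≠ 0 := three_ne_zero
  obtain ⟨α, hα⟩ := IsAlgClosed.exists_pow_nat_eq (3 * ε) two_pos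
  have hα0 : α ≠ 0 := by
    rintro rfl
    simp [h3, hε] at hα
  obtain rfl : ε = α ^ 2 / 3 := by field_simp; linear_combination -hα
  have h9 : (9 : K) ≠ 0 := by simpa [show (9 : K) = 3 * 3 by norm_num] using h3
  have hdet : (!![1 / 3, -1 / 3; α / 3, α / 3] : Matrix (Fin 2) (Fin 2) K).det = 2 * α / 9 := by
    rw [Matrix.det_fin_two_of]
    field_simp
    ring
  refine ⟨.mkOfDetNeZero _ (hdet.trans_ne (by simp [h2, h9, hα0])), ?_⟩
  rw [gl_smul_eq_iff]
  refine Eq.trans ?_ (congrArg (· • normalForm _) hdet.symm)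
  ext <;> simp [subst, smul_def, normalForm, sumOfCubes, Matrix.GeneralLinearGroup.mkOfDetNeZero]
    <;> field_simp <;> ring

theorem exists_gl_smul_sumOfCubes_eq [IsAlgClosed K] [NeZero (2 : K)] [NeZero (3 : K)]
    {f : BinaryCubicForm K} (hf : f.disc ≠ 0) : ∃ M : GL (Fin 2) K, M • sumOfCubes K = f := by
  obtain ⟨v, hv, h⟩ := f.exists_eval_eq_zero_of_isAlgClosed
  obtain ⟨M, ε, hM⟩ := exists_gl_smul_eq_normalForm hf hv h
  have hε : ε ≠ 0 := by
    rintro rfl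
    have := disc_gl_smul M f
    rw [hM, disc_normalForm, mul_zero, eq_comm] at this
    exact mul_ne_zero (pow_ne_zero _ M.det_ne_zero) hf this
  obtain ⟨N, hN⟩ := exists_gl_smul_sumOfCubes_eq_normalForm hε
  exact ⟨M⁻¹ * N, by rw [mul_smul, hN, ← hM, inv_smul_smul]⟩

/-- The matrix of the stabilizer of `X³ + Y³` with the sum `z` of its first row, for a sixth root of
unity `z`. -/
noncomputable def cubesStabilizerMatrix [DecidableEq K] (z : K) : Matrix (Fin 2) (Fin 2) K :=
  if z ^ 3 = 1 then !![z, 0; 0, z ^ 2] else !![0, z; -z ^ 2, 0]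

theorem mul_eq_zero_of_gl_smul_sumOfCubes [NeZero (3 : K)] {M : GL (Fin 2) K}
    (hM : M • sumOfCubes K = sumOfCubes K) :
    M.val 0 0 * M.val 1 0 = 0 ∧ M.val 0 1 * M.val 1 1 = 0 := by
  rw [gl_smul_eq_iff] at hM
  have hdet : M.val 0 0 * M.val 1 1 - M.val 0 1 * M.val 1 0 ≠ 0 :=
    M.val.det_fin_two ▸ M.det_ne_zero
  have hb := congrArg BinaryCubicForm.b hM
  have hc := congrArg BinaryCubicForm.c hM
  simp only [subst, smul_def, sumOfCubes] at hb hc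
  have hdet3 := mul_ne_zero (three_ne_zero (α := K)) hdet
  exact ⟨mul_left_cancel₀ hdet3 (by linear_combination M.val 1 1 * hb - M.val 0 1 * hc),
    mul_left_cancel₀ hdet3 (by linear_combination M.val 0 0 * hc - M.val 1 0 * hb)⟩

theorem coe_eq_cubesStabilizerMatrix [DecidableEq K] [NeZero (2 : K)] [NeZero (3 : K)]
    {M : GL (Fin 2) K} (hM : M • sumOfCubes K = sumOfCubes K) :
    (M.val 0 0 + M.val 0 1) ^ 6 = 1 ∧ M.val = cubesStabilizerMatrix (M.val 0 0 + M.val 0 1) := by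
  obtain ⟨hpu, hqv⟩ := mul_eq_zero_of_gl_smul_sumOfCubes hM
  rw [gl_smul_eq_iff] at hM
  have hdet := M.det_ne_zero
  generalize M.val = N at *
  obtain ⟨p, q, u, v, rfl⟩ : ∃ p q u v, N = !![p, q; u, v] := ⟨_, _, _, _, N.eta_fin_two⟩
  have ha : p ^ 3 + q ^ 3 = p * v - q * u := by
    simpa [subst, smul_def, sumOfCubes] using congrArg BinaryCubicForm.a hM
  have hd : u ^ 3 + v ^ 3 = p * v - q * u := by
    simpa [subst, smul_def, sumOfCubes] using congrArg BinaryCubicForm.d hM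
  simp only [Matrix.det_fin_two_of] at hdet
  simp only [Matrix.of_apply, Matrix.cons_val', Matrix.cons_val_zero, Matrix.cons_val_one,
    Matrix.cons_val_fin_one] at hpu hqv ⊢
  rcases eq_or_ne p 0 with rfl | hp
  · have hq : q ≠ 0 := by rintro rfl; simp at hdet
    obtain rfl : v = 0 := (mul_eq_zero.1 hqv).resolve_left hq
    obtain rfl : u = -q ^ 2 := mul_left_cancel₀ hq (by linear_combination ha)
    have hq3 : q ^ 3 = -1 :=
      mul_left_cancel₀ (pow_ne_zero 3 hq) (by linear_combination -hd)
    have hne : (-1 : K) ≠ 1 := fun h => two_ne_zero (α := K) (by linear_combination -h)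
    exact ⟨by linear_combination (q ^ 3 - 1) * hq3, by simp [cubesStabilizerMatrix, hq3, hne]⟩
  · obtain rfl : u = 0 := (mul_eq_zero.1 hpu).resolve_left hp
    have hv : v ≠ 0 := by rintro rfl; simp at hdet
    obtain rfl : q = 0 := (mul_eq_zero.1 hqv).resolve_right hv
    obtain rfl : v = p ^ 2 := mul_left_cancel₀ hp (by linear_combination -ha)
    have hp3 : p ^ 3 = 1 :=
      mul_left_cancel₀ (pow_ne_zero 3 hp) (by linear_combination hd)
    exact ⟨by linear_combination (p ^ 3 + 1) * hp3, by simp [cubesStabilizerMatrix, hp3]⟩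

theorem finite_stabilizer_sumOfCubes_and_card_le [NeZero (2 : K)] [NeZero (3 : K)] :
    Finite (MulAction.stabilizer (GL (Fin 2) K) (sumOfCubes K)) ∧
      Nat.card (MulAction.stabilizer (GL (Fin 2) K) (sumOfCubes K)) ≤ 6 := by
  classical
  let φ : MulAction.stabilizer (GL (Fin 2) K) (sumOfCubes K) →
      Polynomial.nthRootsFinset 6 (1 : K) :=
    fun M => ⟨_, (Polynomial.mem_nthRootsFinset (by norm_num) 1).2
      (coe_eq_cubesStabilizerMatrix M.2).1⟩
  have hφ : Function.Injective φ := fun M N h => Subtype.ext <| Units.ext <| by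
    rw [(coe_eq_cubesStabilizerMatrix M.2).2, (coe_eq_cubesStabilizerMatrix N.2).2]
    exact congrArg (cubesStabilizerMatrix ∘ Subtype.val) h
  refine ⟨.of_injective φ hφ, (Nat.card_le_card_of_injective φ hφ).trans ?_⟩
  rw [Nat.card_eq_fintype_card, Fintype.card_coe, Polynomial.nthRootsFinset_def]
  exact (Multiset.toFinset_card_le _).trans (Polynomial.card_nthRoots 6 1)

theorem finite_stabilizer_and_card_le {A : Type*} [CommRing A] [IsDomain A] [NeZero (2 : A)]
    [NeZero (3 : A)] {f : BinaryCubicForm A} (hf : f.disc ≠ 0) :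
    Finite (MulAction.stabilizer (GL (Fin 2) A) f) ∧
      Nat.card (MulAction.stabilizer (GL (Fin 2) A) f) ≤ 6 := by
  let L := AlgebraicClosure (FractionRing A)
  let ι : A →+* L := (algebraMap (FractionRing A) L).comp (algebraMap A (FractionRing A))
  have hι : Function.Injective ι :=
    (algebraMap (FractionRing A) L).injective.comp (IsFractionRing.injective A _)
  have : NeZero (2 : L) := ⟨map_ofNat ι 2 ▸ (map_ne_zero_iff ι hι).2 two_ne_zero⟩
  have : NeZero (3 : L) := ⟨map_ofNat ι 3 ▸ (map_ne_zero_iff ι hι).2 three_ne_zero⟩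
  obtain ⟨N, hN⟩ := exists_gl_smul_sumOfCubes_eq (K := L) (f := f.map ι)
    (by rw [disc_map]; exact (map_ne_zero_iff ι hι).2 hf)
  let e := MulAction.stabilizerEquivStabilizer hN.symm
  obtain ⟨hfin, hcard⟩ := finite_stabilizer_sumOfCubes_and_card_le (K := L)
  let φ (M : MulAction.stabilizer (GL (Fin 2) A) f) :
      MulAction.stabilizer (GL (Fin 2) L) (f.map ι) :=
    ⟨Matrix.GeneralLinearGroup.map ι M.1,
      (map_gl_smul ι M.1 f).symm.trans (congrArg (map ι) M.2)⟩
  have hφ : Function.Injective φ := fun M N h => Subtype.ext <| Units.ext <|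
    Matrix.map_injective hι (congrArg (fun M => M.1.val) h)
  have hinj := e.symm.injective.comp hφ
  exact ⟨.of_injective _ hinj, (Nat.card_le_card_of_injective _ hinj).trans hcard⟩

end Stabilizer

end BinaryCubicForm

/-! ### Real forms and their roots -/

theorem projectivization_mk_eq_mk_iff_mul_eq_mul {K : Type*} [Field K] {v w : Fin 2 → K}
    (hv : v ≠ 0) (hw : w ≠ 0) :
    Projectivization.mk K v hv = Projectivization.mk K w hw ↔ v 0 * w 1 = v 1 * w 0 := by
  rw [Projectivization.mk_eq_mk_iff']
  constructor
  · rintro ⟨x, rfl⟩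
    simp only [Pi.smul_apply, smul_eq_mul]
    ring
  · intro h
    by_cases h0 : w 0 = 0
    · have h1 : w 1 ≠ 0 := fun h1 => hw (by ext i; fin_cases i <;> simp [h0, h1])
      have hv0 : v 0 = 0 := by simpa [h0, h1] using h
      refine ⟨v 1 / w 1, funext fun i => ?_⟩
      fin_cases i <;> simp [h0, h1, hv0]
    · refine ⟨v 0 / w 0, funext fun i => ?_⟩
      fin_cases i
      · simp [h0]
      · simp only [Pi.smul_apply, smul_eq_mul, Fin.mk_one]
        field_simp
        rw [h, mul_comm]

theorem squarefree_mulEquiv_iff {R S F : Type*} [Monoid R] [Monoid S] [EquivLike F R S]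
    [MulEquivClass F R S] (e : F) {x : R} : Squarefree (e x) ↔ Squarefree x := by
  constructor <;> intro h y hy
  · exact (isUnit_map_iff e y).1 (h _ (by simpa using map_dvd e hy))
  · obtain ⟨y, rfl⟩ := EquivLike.surjective e y
    rw [← map_mul, map_dvd_iff e] at hy
    exact (h y hy).map e

namespace BinaryCubicForm

section RootSet

variable {K : Type*} [Field K]

/-- The roots of a binary cubic form on the projective line. -/
def rootSet (f : BinaryCubicForm K) : Set (ℙ K (Fin 2 → K)) := {p | f.eval p.rep = 0}

theorem mk_mem_rootSet {f : BinaryCubicForm K} {v : Fin 2 → K} (hv : v ≠ 0) :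
    Projectivization.mk K v hv ∈ f.rootSet ↔ f.eval v = 0 := by
  obtain ⟨x, hx⟩ := Projectivization.exists_smul_eq_mk_rep K v hv
  rw [rootSet, mem_ofPred_eq, ← hx, Units.smul_def, eval_smul_vec]
  simp

theorem encard_rootSet_gl_smul_le (M : GL (Fin 2) K) (f : BinaryCubicForm K) :
    (M • f).rootSet.encard ≤ f.rootSet.encard := by
  have hinj : Function.Injective M.val.transpose.mulVecLin := by
    rw [Matrix.coe_mulVecLin, Matrix.mulVec_injective_iff_isUnit, Matrix.isUnit_transpose]
    exact M.isUnit
  refine encard_le_encard_of_injOn (f := Projectivization.map M.val.transpose.mulVecLin hinj) ?_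
    (Projectivization.map_injective _ hinj).injOn
  intro p
  induction p using Projectivization.ind with
  | h v hv =>
    intro h
    rw [mk_mem_rootSet, eval_smul] at h
    rw [Projectivization.map_mk, mk_mem_rootSet]
    exact (mul_eq_zero.1 h).resolve_left (Units.ne_zero _)

theorem ncard_rootSet_gl_smul (M : GL (Fin 2) K) (f : BinaryCubicForm K) :
    (M • f).rootSet.ncard = f.rootSet.ncard := by
  refine congrArg ENat.toNat (le_antisymm (encard_rootSet_gl_smul_le M f) ?_)
  simpa using encard_rootSet_gl_smul_le M⁻¹ (M • f)

theorem ncard_rootSet_normalForm_one : (normalForm (1 : ℝ)).rootSet.ncard = 1 := by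
  refine ncard_eq_one.2 ⟨Projectivization.mk ℝ ![1, 0] (by simp), ?_⟩
  ext p
  induction p using Projectivization.ind with
  | h v hv =>
    have hfac : (normalForm (1 : ℝ)).eval v = v 1 * (v 0 ^ 2 + v 1 ^ 2) := by
      simp [eval, normalForm]
      ring
    have hpos : v 1 ≠ 0 → v 0 ^ 2 + v 1 ^ 2 ≠ 0 := fun h => by positivity
    simp only [mk_mem_rootSet, mem_singleton_iff, projectivization_mk_eq_mk_iff_mul_eq_mul, hfac,
      Matrix.cons_val_zero, Matrix.cons_val_one, mul_zero, mul_one, mul_eq_zero,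
      eq_comm (a := (0 : ℝ))]
    tauto

theorem ncard_rootSet_normalForm_neg_one : (normalForm (-1 : ℝ)).rootSet.ncard = 3 := by
  refine ncard_eq_three.2 ⟨Projectivization.mk ℝ ![1, 0] (by simp),
    Projectivization.mk ℝ ![1, 1] (by simp), Projectivization.mk ℝ ![1, -1] (by simp),
    ?_, ?_, ?_, ?_⟩
  · simp [projectivization_mk_eq_mk_iff_mul_eq_mul]
  · simp [projectivization_mk_eq_mk_iff_mul_eq_mul]
  · norm_num [projectivization_mk_eq_mk_iff_mul_eq_mul]
  ext p
  induction p using Projectivization.ind with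
  | h v hv =>
    have hfac : (normalForm (-1 : ℝ)).eval v = v 1 * ((v 0 - v 1) * (v 0 + v 1)) := by
      simp [eval, normalForm]
      ring
    rw [mk_mem_rootSet, hfac]
    simp only [mem_insert_iff, mem_singleton_iff,
      projectivization_mk_eq_mk_iff_mul_eq_mul, Matrix.cons_val_zero, Matrix.cons_val_one,
      mul_zero, mul_one, mul_neg, mul_eq_zero, sub_eq_zero]
    grind

end RootSet

section Signature

variable {f g : BinaryCubicForm ℝ}

theorem exists_gl_smul_eq_normalForm_one_or_neg_one (hf : f.disc ≠ 0) :
    ∃ M : GL (Fin 2) ℝ, M • f = normalForm 1 ∨ M • f = normalForm (-1) := by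
  obtain ⟨v, hv, h⟩ := f.exists_eval_eq_zero_of_real
  obtain ⟨M, ε, hM⟩ := exists_gl_smul_eq_normalForm hf hv h
  have hε : ε ≠ 0 := by
    rintro rfl
    have := disc_gl_smul M f
    rw [hM, disc_normalForm, mul_zero, eq_comm] at this
    exact mul_ne_zero (pow_ne_zero _ M.det_ne_zero) hf this
  obtain ⟨N, hN⟩ := exists_gl_smul_normalForm_eq (Real.sqrt_ne_zero'.2 (abs_pos.2 hε)) ε
  refine ⟨N * M, ?_⟩
  rw [mul_smul, hM, hN, Real.sq_sqrt (abs_nonneg ε)]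
  rcases abs_choice ε with h | h
  · exact .inl (by rw [h, div_self hε])
  · exact .inr (by rw [h, div_neg, div_self hε])

theorem disc_gl_smul_pos_iff (M : GL (Fin 2) ℝ) (f : BinaryCubicForm ℝ) :
    0 < (M • f).disc ↔ 0 < f.disc := by
  rw [disc_gl_smul, mul_pos_iff_of_pos_left (sq_pos_of_ne_zero M.det_ne_zero)]

theorem ncard_rootSet_eq (hf : f.disc ≠ 0) : f.rootSet.ncard = if 0 < f.disc then 3 else 1 := by
  obtain ⟨M, hM⟩ := exists_gl_smul_eq_normalForm_one_or_neg_one hf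
  rw [← ncard_rootSet_gl_smul M]
  rw [← if_congr (disc_gl_smul_pos_iff M f) rfl rfl]
  rcases hM with hM | hM <;>
    norm_num [hM, disc_normalForm, ncard_rootSet_normalForm_one, ncard_rootSet_normalForm_neg_one]

theorem exists_gl_smul_eq (h : 0 < f.disc * g.disc) : ∃ M : GL (Fin 2) ℝ, M • f = g := by
  obtain ⟨M, hM⟩ := exists_gl_smul_eq_normalForm_one_or_neg_one (left_ne_zero_of_mul h.ne')
  obtain ⟨N, hN⟩ := exists_gl_smul_eq_normalForm_one_or_neg_one (right_ne_zero_of_mul h.ne')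
  have hMN : 0 < (M • f).disc * (N • g).disc := by
    rw [disc_gl_smul, disc_gl_smul, mul_mul_mul_comm]
    have := M.det_ne_zero
    have := N.det_ne_zero
    positivity
  refine ⟨N⁻¹ * M, ?_⟩
  rw [mul_smul, inv_smul_eq_iff]
  rcases hM with hM | hM <;> rcases hN with hN | hN <;> rw [hM, hN] at hMN ⊢ <;>
    norm_num [disc_normalForm] at hMN

/-- The sign of the discriminant of the forms with `r` real roots, for `r = 1, 3`. -/
def discSign (r : ℕ) : ℝ := if r = 1 then -1 else 1

theorem mem_signatureSet_iff {r : ℕ} (hr : r = 1 ∨ r = 3) (hf : f.disc ≠ 0) :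
    f ∈ signatureSet r ↔ 0 < discSign r * f.disc := by
  have : f ∈ signatureSet r ↔ f.rootSet.ncard = r :=
    ⟨fun h => h.2, fun h => ⟨squarefree_toMvPolynomial hf, h⟩⟩
  rw [this, ncard_rootSet_eq hf]
  rcases hf.lt_or_gt with h | h <;> rcases hr with rfl | rfl <;> simp [discSign, h, h.not_gt]

theorem gl_smul_mem_signatureSet_iff (M : GL (Fin 2) ℝ) (f : BinaryCubicForm ℝ) (r : ℕ) :
    M • f ∈ signatureSet r ↔ f ∈ signatureSet r := by
  refine and_congr ?_ (iff_of_eq (congrArg (· = r) (ncard_rootSet_gl_smul M f)))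
  rw [← (associated_substEquiv_toMvPolynomial M f).squarefree_iff]
  exact squarefree_mulEquiv_iff (substEquiv M)

end Signature

section Integral

variable {f : BinaryCubicForm ℤ}

theorem IrreducibleOverRat.a_ne_zero (hf : f.IrreducibleOverRat) : f.a ≠ 0 :=
  fun h => a_ne_zero_of_irreducible hf (by simp [map, h])

theorem eval_intCast_ne_zero_of_odd (ha : Odd f.a) (hd : Odd f.d) (hbc : Odd (f.b + f.c)) {x y : ℤ}
    (hxy : IsCoprime x y) : f.eval ![x, y] ≠ 0 := by
  intro h
  have key : ∀ a b c d x y : ZMod 2, a = 1 → d = 1 → b + c = 1 →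
      a * x ^ 3 + b * x ^ 2 * y + c * x * y ^ 2 + d * y ^ 3 = 0 → x = 0 ∧ y = 0 := by decide
  have h2 := congrArg (Int.cast : ℤ → ZMod 2) h
  simp only [eval, Matrix.cons_val_zero, Matrix.cons_val_one, Int.cast_add, Int.cast_mul,
    Int.cast_pow, Int.cast_zero] at h2
  obtain ⟨hx, hy⟩ := key f.a f.b f.c f.d x y (ZMod.intCast_eq_one_iff_odd.2 ha)
    (ZMod.intCast_eq_one_iff_odd.2 hd) (by exact_mod_cast ZMod.intCast_eq_one_iff_odd.2 hbc) h2
  rw [ZMod.intCast_zmod_eq_zero_iff_dvd] at hx hy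
  exact absurd (hxy.isUnit_of_dvd' hx hy) (by decide)

theorem exists_isCoprime_smul_eq {v : Fin 2 → ℚ} (hv : v ≠ 0) :
    ∃ (z : ℚ) (x y : ℤ), z ≠ 0 ∧ IsCoprime x y ∧ v = z • ((↑) ∘ ![x, y]) := by
  by_cases h1 : v 1 = 0
  · have h0 : v 0 ≠ 0 := fun h0 => hv (by ext i; fin_cases i <;> simp [h0, h1])
    refine ⟨v 0, 1, 0, h0, isCoprime_one_left, ?_⟩
    ext i
    fin_cases i <;> simp [h1]
  · set x : ℚ := v 0 / v 1 with hx
    have hden : (x.den : ℚ) ≠ 0 := by exact_mod_cast x.den_nz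
    refine ⟨v 1 / x.den, x.num, x.den, div_ne_zero h1 hden,
      Int.isCoprime_iff_gcd_eq_one.2 x.reduced, funext fun i => ?_⟩
    fin_cases i
    · have hv0 : v 0 = x * v 1 := by rw [hx]; field_simp
      simp only [Fin.zero_eta, hv0, Pi.smul_apply, smul_eq_mul, Function.comp_apply,
        Matrix.cons_val_zero, ← Rat.mul_den_eq_num x]
      field_simp
    · simp [hden]

theorem irreducibleOverRat_of_odd (ha : Odd f.a) (hd : Odd f.d) (hbc : Odd (f.b + f.c)) :
    f.IrreducibleOverRat := by
  apply irreducible_toMvPolynomial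
  intro v hv
  obtain ⟨z, x, y, hz, hxy, rfl⟩ := exists_isCoprime_smul_eq hv
  rw [eval_smul_vec]
  refine mul_ne_zero (pow_ne_zero 3 hz) ?_
  refine (eval_map (Int.castRingHom ℚ) f ![x, y]).trans_ne ?_
  exact Int.cast_ne_zero.2 (eval_intCast_ne_zero_of_odd ha hd hbc hxy)

theorem det_map_intCast_sq (γ : GL (Fin 2) ℤ) :
    (Matrix.GeneralLinearGroup.map (Int.castRingHom ℝ) γ).val.det ^ 2 = 1 := by
  have h : γ.val.det ^ 2 = 1 := Int.isUnit_sq ((Matrix.isUnit_iff_isUnit_det _).1 γ.isUnit)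
  calc (Matrix.GeneralLinearGroup.map (Int.castRingHom ℝ) γ).val.det ^ 2
      = Int.castRingHom ℝ γ.val.det ^ 2 := congrArg (· ^ 2) (RingHom.map_det _ _).symm
    _ = 1 := by rw [← map_pow, h, map_one]

theorem toReal_gl_smul (γ : GL (Fin 2) ℤ) (f : BinaryCubicForm ℤ) :
    (γ • f).toReal = Matrix.GeneralLinearGroup.map (Int.castRingHom ℝ) γ • f.toReal :=
  map_gl_smul _ γ f

theorem disc_toReal_gl_smul (γ : GL (Fin 2) ℤ) (f : BinaryCubicForm ℤ) :
    (γ • f).toReal.disc = f.toReal.disc := by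
  rw [toReal_gl_smul, disc_gl_smul, det_map_intCast_sq, one_mul]

theorem isTarget_gl_smul_iff (r : ℕ) (T : ℝ) (γ : GL (Fin 2) ℤ) (f : BinaryCubicForm ℤ) :
    IsTarget r T (γ • f) ↔ IsTarget r T f := by
  rw [IsTarget, IrreducibleOverRat, map_gl_smul, irreducible_toMvPolynomial_gl_smul_iff,
    disc_toReal_gl_smul, toReal_gl_smul, gl_smul_mem_signatureSet_iff]
  rfl

end Integral

end BinaryCubicForm

/-! ### The action on the upper half-plane -/

namespace BinaryCubicForm

open CubicSampling UpperHalfPlane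

/-- Conjugation with the permutation matrix. The forms are acted on through the transpose, so it is
`twist M`, rather than `M`, that has to act on the upper half-plane for `n(t) a(s)` to send `i` to
`t + i s²`. -/
def twist {A : Type*} [CommRing A] : GL (Fin 2) A ≃* GL (Fin 2) A :=
  Units.mapEquiv (Matrix.reindexRingEquiv A (Equiv.swap (0 : Fin 2) 1)).toMulEquiv

theorem val_twist {A : Type*} [CommRing A] (M : GL (Fin 2) A) :
    (twist M).val = !![M.val 1 1, M.val 1 0; M.val 0 1, M.val 0 0] := by
  ext i j
  fin_cases i <;> fin_cases j <;> rfl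

theorem det_twist {A : Type*} [CommRing A] (M : GL (Fin 2) A) :
    (twist M).val.det = M.val.det := by
  rw [val_twist, Matrix.det_fin_two_of, Matrix.det_fin_two]
  ring

theorem map_twist {A B : Type*} [CommRing A] [CommRing B] (φ : A →+* B) (M : GL (Fin 2) A) :
    Matrix.GeneralLinearGroup.map φ (twist M) = twist (Matrix.GeneralLinearGroup.map φ M) := by
  ext i j
  fin_cases i <;> fin_cases j <;> rfl

theorem q_smul (x : ℝ) (f : BinaryCubicForm ℝ) : q (x • f) = x ^ 2 * q f := by
  simp only [q, smul_def]
  ring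

theorem val_eq_of_twist_smul_I_eq_I {M : GL (Fin 2) ℝ} (hM : twist M • I = I) :
    ∃ x y : ℝ, M.val = !![x, y; -y, x] ∨ M.val = !![x, y; y, -x] := by
  have hd := denom_ne_zero (twist M) I
  have hI := congrArg UpperHalfPlane.coe hM
  rw [coe_smul, σ] at hI
  refine ⟨M.val 0 0, M.val 0 1, ?_⟩
  rw [← Matrix.ext_iff, ← Matrix.ext_iff]
  split_ifs at hI with hdet
  · left
    rw [ContinuousAlgEquiv.refl_apply, div_eq_iff hd] at hI
    have h0 := congrArg Complex.re hI
    have h1 := congrArg Complex.im hI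
    simp [num, denom, val_twist] at h0 h1
    simp [Fin.forall_fin_two, h0, h1]
  · right
    rw [Complex.conjCAE_apply, ← (starRingEnd ℂ).injective.eq_iff, Complex.conj_conj,
      div_eq_iff hd] at hI
    have h0 := congrArg Complex.re hI
    have h1 := congrArg Complex.im hI
    simp [num, denom, val_twist] at h0 h1
    simp [Fin.forall_fin_two, h0, h1]

theorem q_gl_smul_of_twist_smul_I_eq_I {M : GL (Fin 2) ℝ} (hM : twist M • I = I)
    (f : BinaryCubicForm ℝ) : q (M • f) = |M.val.det| * q f := by
  have hdet : 0 < |M.val.det| := abs_pos.2 M.det_ne_zero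
  have hsubst : |M.val.det| ^ 2 * q (M • f) = |M.val.det| ^ 3 * q f := by
    rw [sq_abs, ← q_smul, ← gl_smul_eq_iff.1 rfl]
    obtain ⟨x, y, h | h⟩ := val_eq_of_twist_smul_I_eq_I hM
    · rw [h, Matrix.det_fin_two_of, abs_of_nonneg (by nlinarith [sq_nonneg x, sq_nonneg y])]
      simp [q, subst]
      ring
    · rw [h, Matrix.det_fin_two_of, abs_of_nonpos (by nlinarith [sq_nonneg x, sq_nonneg y])]
      simp [q, subst]
      ring
  exact mul_left_cancel₀ (pow_pos hdet 2).ne' (hsubst.trans (by ring))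

/-- The point `t + i s²` of the upper half-plane, to which `n(t) a(s)` moves `i`. -/
noncomputable def point (t s : ℝ) (hs : 0 < s) : ℍ := ⟨⟨t, s ^ 2⟩, by positivity⟩

theorem val_nMat_mul_aMat (t : ℝ) {s : ℝ} (hs : 0 < s) :
    (nMat t * aMat s).val = !![s⁻¹, 0; t * s⁻¹, s] := by
  rw [Units.val_mul, aMat, dif_pos hs.ne']
  simp [nMat, Matrix.GeneralLinearGroup.mkOfDetNeZero]

theorem det_nMat_mul_aMat (t : ℝ) {s : ℝ} (hs : 0 < s) : (nMat t * aMat s).val.det = 1 := by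
  rw [val_nMat_mul_aMat t hs, Matrix.det_fin_two_of, zero_mul, sub_zero, inv_mul_cancel₀ hs.ne']

theorem twist_nMat_mul_aMat_smul_I (t : ℝ) {s : ℝ} (hs : 0 < s) :
    twist (nMat t * aMat s) • I = point t s hs := by
  have hdet : 0 < (twist (nMat t * aMat s)).det.val := by
    rw [Matrix.GeneralLinearGroup.val_det_apply, det_twist, det_nMat_mul_aMat t hs]
    exact one_pos
  have hs' : (s : ℂ) ≠ 0 := by exact_mod_cast hs.ne'
  have hp : (point t s hs : ℂ) = t + s ^ 2 * Complex.I := by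
    apply Complex.ext <;> simp [point, ← Complex.ofReal_pow]
  apply UpperHalfPlane.ext
  rw [coe_smul_of_det_pos hdet, hp, num, denom, val_twist, val_nMat_mul_aMat t hs]
  simp
  field_simp
  ring

/-- The value of `q` at `g⁻¹ f`, where `g = n(t) a(s)` and `τ = t + i s²`. -/
noncomputable def height (f : BinaryCubicForm ℝ) (τ : ℍ) : ℝ :=
  q ((nMat τ.re * aMat √τ.im)⁻¹ • f)

theorem height_point (f : BinaryCubicForm ℝ) (t : ℝ) {s : ℝ} (hs : 0 < s) :
    f.height (point t s hs) = q ((nMat t * aMat s)⁻¹ • f) := by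
  rw [height, point, mk_re, mk_im, Real.sqrt_sq hs.le]

theorem twist_frame_smul_I (τ : ℍ) : twist (nMat τ.re * aMat √τ.im) • I = τ := by
  rw [twist_nMat_mul_aMat_smul_I _ (Real.sqrt_pos.2 τ.im_pos)]
  exact UpperHalfPlane.ext_re_im rfl (Real.sq_sqrt τ.im_pos.le)

theorem height_gl_smul (M : GL (Fin 2) ℝ) (f : BinaryCubicForm ℝ) (τ : ℍ) :
    (M • f).height (twist M • τ) = |M.val.det| * f.height τ := by
  rw [height, height]
  set g := nMat τ.re * aMat √τ.im
  set h := nMat (twist M • τ).re * aMat √(twist M • τ).im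
  have hgdet : g.val.det = 1 := det_nMat_mul_aMat _ (Real.sqrt_pos.2 τ.im_pos)
  have hhdet : h.val.det = 1 := det_nMat_mul_aMat _ (Real.sqrt_pos.2 (im_pos _))
  have hI : twist (h⁻¹ * M * g) • I = I := by
    rw [map_mul, map_mul, map_inv, mul_smul, mul_smul, twist_frame_smul_I, inv_smul_eq_iff,
      twist_frame_smul_I]
  have hdet : (h⁻¹ * M * g).val.det = M.val.det := by
    have := congrArg (fun N : GL (Fin 2) ℝ => N.val.det) (mul_inv_cancel h)
    simp only [Units.val_mul, Matrix.det_mul, hhdet, one_mul, Units.val_one, Matrix.det_one] at this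
    rw [Units.val_mul, Units.val_mul, Matrix.det_mul, Matrix.det_mul, this, hgdet, one_mul, mul_one]
  rw [← hdet, ← q_gl_smul_of_twist_smul_I_eq_I hI, mul_smul, smul_inv_smul, mul_smul]

theorem height_smul (x : ℝ) (f : BinaryCubicForm ℝ) (τ : ℍ) :
    (x • f).height τ = x ^ 2 * f.height τ := by
  rw [height, gl_smul_smul_comm, q_smul, height]

theorem height_I (f : BinaryCubicForm ℝ) : f.height I = f.q := by
  have : f.height I = f.height (point 0 1 one_pos) := by
    congr 1
    ext
    simp [point, Complex.ext_iff]
  rw [this, height_point]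
  have h1 : nMat 0 * aMat 1 = 1 := by
    ext i j
    rw [val_nMat_mul_aMat 0 one_pos]
    fin_cases i <;> fin_cases j <;> simp
  rw [h1, inv_one, one_smul]

theorem mem_smul_unitBall_iff (f : BinaryCubicForm ℝ) {ρ : ℝ} (hρ : 0 < ρ) (t : ℝ) {s : ℝ}
    (hs : 0 < s) :
    f ∈ ρ • (nMat t * aMat s) • unitBall ↔ f.height (point t s hs) < ρ ^ 2 := by
  rw [height_point]
  generalize nMat t * aMat s = g
  have hmem (f : BinaryCubicForm ℝ) : f ∈ unitBall ↔ q f < 1 := by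
    rw [unitBall, mem_ofPred_eq, Real.sqrt_lt' one_pos, one_pow]
  constructor
  · rintro ⟨_, ⟨f, hf, rfl⟩, rfl⟩
    simp only
    rw [gl_smul_smul_comm, inv_smul_smul, q_smul]
    nlinarith [(hmem f).1 hf, pow_pos hρ 2]
  · intro h
    refine ⟨ρ⁻¹ • f, ⟨g⁻¹ • ρ⁻¹ • f, ?_, smul_inv_smul _ _⟩, ?_⟩
    · rw [hmem, gl_smul_smul_comm, q_smul, inv_pow, inv_mul_lt_iff₀ (by positivity), mul_one]
      exact h
    · ext <;> exact mul_inv_cancel_left₀ hρ.ne' _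

theorem height_eq (f : BinaryCubicForm ℝ) (τ : ℍ) :
    f.height τ = 5 * f.a ^ 2 * τ.im ^ 3
      + ((f.b - 3 * f.a * τ.re) ^ 2
          + 2 * f.a * (f.c - 2 * f.b * τ.re + 3 * f.a * τ.re ^ 2)) * τ.im
      + ((f.c - 2 * f.b * τ.re + 3 * f.a * τ.re ^ 2) ^ 2
          + 2 * (f.b - 3 * f.a * τ.re)
            * (f.d - f.c * τ.re + f.b * τ.re ^ 2 - f.a * τ.re ^ 3)) / τ.im
      + 5 * (f.d - f.c * τ.re + f.b * τ.re ^ 2 - f.a * τ.re ^ 3) ^ 2 / τ.im ^ 3 := by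
  have hs := Real.sqrt_pos.2 τ.im_pos
  set s := √τ.im
  have hsq : τ.im = s ^ 2 := (Real.sq_sqrt τ.im_pos.le).symm
  set t := τ.re
  have hf : (nMat t * aMat s)⁻¹ • f = (⟨s ^ 3 * f.a, s * (f.b - 3 * f.a * t),
      s⁻¹ * (f.c - 2 * f.b * t + 3 * f.a * t ^ 2),
      (s ^ 3)⁻¹ * (f.d - f.c * t + f.b * t ^ 2 - f.a * t ^ 3)⟩ : BinaryCubicForm ℝ) := by
    rw [inv_smul_eq_iff, eq_comm, gl_smul_eq_iff, det_nMat_mul_aMat t hs, val_nMat_mul_aMat t hs]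
    ext <;> simp [subst, smul_def] <;> field_simp <;> ring
  rw [height, hf, hsq, q]
  field_simp
  ring

theorem continuous_height_ofCoeffs :
    Continuous fun p : (Fin 4 → ℝ) × ℍ => (ofCoeffs p.1).height p.2 := by
  have him (p : (Fin 4 → ℝ) × ℍ) : p.2.im ≠ 0 := p.2.im_pos.ne'
  simp only [height_eq, ofCoeffs]
  fun_prop (disch := simp [him])

/-- The set of points of the upper half-plane at which the height of `f` is small relative to its
discriminant; `n(t) a(s)` moves `i` into it exactly if `f ∈ R |disc f|^(1/4) n(t) a(s) B`. -/
def lowSet (R : ℝ) (f : BinaryCubicForm ℝ) : Set ℍ := {τ | f.height τ < R ^ 2 * √|f.disc|}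

theorem twist_smul_mem_lowSet_iff (R : ℝ) (M : GL (Fin 2) ℝ) (f : BinaryCubicForm ℝ) (τ : ℍ) :
    twist M • τ ∈ lowSet R (M • f) ↔ τ ∈ lowSet R f := by
  rw [lowSet, lowSet, mem_ofPred_eq, mem_ofPred_eq, height_gl_smul, disc_gl_smul, abs_mul, abs_pow,
    Real.sqrt_mul (by positivity), Real.sqrt_sq (abs_nonneg _), mul_left_comm]
  exact mul_lt_mul_iff_right₀ (abs_pos.2 M.det_ne_zero)

theorem lowSet_smul (R : ℝ) {x : ℝ} (hx : x ≠ 0) (f : BinaryCubicForm ℝ) :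
    lowSet R (x • f) = lowSet R f := by
  have h : √(|x ^ 4 * f.disc|) = x ^ 2 * √|f.disc| := by
    rw [abs_mul, abs_of_nonneg (by positivity), Real.sqrt_mul (by positivity),
      show x ^ 4 = (x ^ 2) ^ 2 by ring, Real.sqrt_sq (sq_nonneg x)]
  ext τ
  rw [lowSet, lowSet, mem_ofPred_eq, mem_ofPred_eq, height_smul, disc_smul, h, mul_left_comm]
  exact mul_lt_mul_iff_right₀ (by positivity)

theorem isOpen_lowSet (R : ℝ) (f : BinaryCubicForm ℝ) : IsOpen (lowSet R f) := by
  obtain ⟨v, rfl⟩ : ∃ v, ofCoeffs v = f := ⟨f.coeffs, rfl⟩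
  exact isOpen_lt continuous_height_ofCoeffs.along_snd continuous_const

theorem volume_lowSet_gl_smul (R : ℝ) (M : GL (Fin 2) ℝ) (f : BinaryCubicForm ℝ) :
    volume (lowSet R (M • f)) = volume (lowSet R f) := by
  rw [← measure_preimage_smul volume (twist M) (lowSet R (M • f))]
  congr 1
  ext τ
  exact twist_smul_mem_lowSet_iff R M f τ

end BinaryCubicForm

/-! ### Orbit sums over the modular group -/

theorem card_stabilizer_mul_tsum_orbit {G X : Type*} [Group G] [MulAction G X] (x : X)
    (φ : X → ℝ≥0∞) :
    ENat.card (MulAction.stabilizer G x) * ∑' y : MulAction.orbit G x, φ y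
      = ∑' g : G, φ (g • x) := by
  let p (g : G) : MulAction.orbit G x := ⟨g • x, g, rfl⟩
  have hfiber (y : MulAction.orbit G x) :
      ENat.card {g // p g = y} = ENat.card (MulAction.stabilizer G x) := by
    obtain ⟨_, h, rfl⟩ := y
    exact ENat.card_congr <| (Equiv.mulLeft h⁻¹).subtypeEquiv fun g => by
      rw [Equiv.coe_mulLeft, MulAction.mem_stabilizer_iff, mul_smul, inv_smul_eq_iff]
      exact Subtype.ext_iff
  have hsum (y : MulAction.orbit G x) :
      ∑' g : {g // p g = y}, φ (g.1 • x) = ENat.card (MulAction.stabilizer G x) * φ y := by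
    rw [← hfiber, ← ENNReal.tsum_const]
    exact tsum_congr fun g => congrArg φ (congrArg Subtype.val g.2)
  rw [← (Equiv.sigmaFiberEquiv p).tsum_eq, ENNReal.tsum_sigma', ← ENNReal.tsum_mul_left]
  exact (tsum_congr hsum).symm

theorem tsum_measure_inter_preimage_smul {G X : Type*} [Group G] [Countable G] [MulAction G X]
    [MeasurableSpace X] [MeasurableConstSMul G X] (μ : Measure X) [SMulInvariantMeasure G X μ]
    {D S : Set X} (hD : MeasurableSet D) {c : ℝ≥0∞}
    (h : ∀ᵐ x ∂μ, ∑' g : G, D.indicator 1 (g • x) = c) :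
    ∑' g : G, μ (D ∩ (g • ·) ⁻¹' S) = c * μ S := by
  have hg (g : G) : μ (D ∩ (g⁻¹ • ·) ⁻¹' S) = ∫⁻ x in S, D.indicator 1 (g • x) ∂μ := by
    have hm : MeasurableSet ((g • ·) ⁻¹' D) := hD.preimage (measurable_const_smul g)
    calc μ (D ∩ (g⁻¹ • ·) ⁻¹' S) = μ ((g • ·) ⁻¹' (D ∩ (g⁻¹ • ·) ⁻¹' S)) :=
          (measure_preimage_smul μ g _).symm
      _ = μ ((g • ·) ⁻¹' D ∩ S) := by
          congr 1
          ext x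
          simp only [mem_preimage, mem_inter_iff, inv_smul_smul]
      _ = ∫⁻ x in S, ((g • ·) ⁻¹' D).indicator 1 x ∂μ := by
          rw [lintegral_indicator_one hm, Measure.restrict_apply hm]
  calc ∑' g : G, μ (D ∩ (g • ·) ⁻¹' S) = ∑' g : G, μ (D ∩ (g⁻¹ • ·) ⁻¹' S) :=
        ((Equiv.inv G).tsum_eq fun g => μ (D ∩ (g • ·) ⁻¹' S)).symm
    _ = ∫⁻ x in S, ∑' g : G, D.indicator 1 (g • x) ∂μ := by
        rw [tsum_congr hg, lintegral_tsum]
        exact fun g => ((measurable_one.indicator hD).comp (measurable_const_smul g)).aemeasurable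
    _ = c * μ S := by
        rw [lintegral_congr_ae (ae_restrict_of_ae h), setLIntegral_const]

namespace BinaryCubicForm

open UpperHalfPlane Modular MatrixGroups

/-- Integral matrices act on the upper half-plane through `GL₂(ℝ)`; those of determinant `-1` act by
anti-holomorphic maps. -/
noncomputable instance : MulAction (GL (Fin 2) ℤ) ℍ :=
  .compHom ℍ (Matrix.GeneralLinearGroup.map (Int.castRingHom ℝ))

theorem int_smul_def (γ : GL (Fin 2) ℤ) (τ : ℍ) :
    γ • τ = Matrix.GeneralLinearGroup.map (Int.castRingHom ℝ) γ • τ := rfl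

instance : MeasurableConstSMul (GL (Fin 2) ℤ) ℍ where
  measurable_const_smul γ :=
    measurable_const_smul (Matrix.GeneralLinearGroup.map (Int.castRingHom ℝ) γ)

instance : SMulInvariantMeasure (GL (Fin 2) ℤ) ℍ volume where
  measure_preimage_smul γ _ hS := SMulInvariantMeasure.measure_preimage_smul
    (Matrix.GeneralLinearGroup.map (Int.castRingHom ℝ) γ) hS

instance : Countable (GL (Fin 2) ℤ) :=
  haveI : Countable (Matrix (Fin 2) (Fin 2) ℤ) := inferInstanceAs (Countable (Fin 2 → Fin 2 → ℤ))
  Units.val_injective.countable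

theorem int_neg_smul (γ : GL (Fin 2) ℤ) (τ : ℍ) : -γ • τ = γ • τ := by
  rw [int_smul_def, int_smul_def, ← UpperHalfPlane.neg_smul]
  congr 1
  ext i j
  simp

theorem coe_smul_eq_smul (g : SL(2, ℤ)) (τ : ℍ) : (g : GL (Fin 2) ℤ) • τ = g • τ := by
  rw [ModularGroup.sl_moeb, int_smul_def]
  rfl

/-- The reflection `diag(-1, 1)`, which acts on the upper half-plane by `τ ↦ -conj τ`. -/
def reflection : GL (Fin 2) ℤ where
  val := !![-1, 0; 0, 1]
  inv := !![-1, 0; 0, 1]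
  val_inv := by decide
  inv_val := by decide

theorem reflection_smul_mem_fdo {τ : ℍ} (h : τ ∈ 𝒟ᵒ) : reflection • τ ∈ 𝒟ᵒ := by
  have hJ : reflection • τ = J • τ := by
    rw [int_smul_def]
    congr 1
    ext i j
    fin_cases i <;> fin_cases j <;> simp [reflection]
  have hre : (J • τ).re = -τ.re := by
    rw [← coe_re, coe_J_smul]
    simp
  rw [hJ]
  refine ⟨?_, ?_⟩
  · rw [coe_J_smul]
    simpa using h.1
  · rw [hre, abs_neg]
    exact h.2

theorem eq_one_or_eq_neg_one_of_smul_mem_fdo {τ : ℍ} (h : τ ∈ 𝒟ᵒ) {γ : GL (Fin 2) ℤ}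
    (hdet : γ.val.det = 1) (hγ : γ • τ ∈ 𝒟ᵒ) : γ = 1 ∨ γ = -1 := by
  obtain ⟨g, rfl⟩ : ∃ g : SL(2, ℤ), (g : GL (Fin 2) ℤ) = γ := ⟨⟨γ.val, hdet⟩, Units.ext rfl⟩
  rw [coe_smul_eq_smul] at hγ
  refine (ModularGroup.eq_one_or_neg_one_of_mem_fdo_mem_fdo h hγ).imp ?_ ?_ <;> rintro rfl <;>
    exact Units.ext (by simp)

theorem smul_mem_fdo_iff {τ : ℍ} (h : τ ∈ 𝒟ᵒ) (γ : GL (Fin 2) ℤ) :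
    γ • τ ∈ 𝒟ᵒ ↔ γ ∈ ({1, -1, reflection, -reflection} : Finset (GL (Fin 2) ℤ)) := by
  simp only [Finset.mem_insert, Finset.mem_singleton]
  constructor
  · intro hγ
    rcases Int.isUnit_iff.1 ((Matrix.isUnit_iff_isUnit_det _).1 γ.isUnit) with hdet | hdet
    · rcases eq_one_or_eq_neg_one_of_smul_mem_fdo h hdet hγ with rfl | rfl <;> simp
    · have hdet' : (reflection * γ).val.det = 1 := by
        rw [Units.val_mul, Matrix.det_mul, hdet]
        rfl
      have hγ' : (reflection * γ) • τ ∈ 𝒟ᵒ := by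
        rw [mul_smul]
        exact reflection_smul_mem_fdo hγ
      have hγ_eq : reflection * (reflection * γ) = γ := by
        rw [← mul_assoc, show reflection * reflection = 1 from by decide, one_mul]
      rcases eq_one_or_eq_neg_one_of_smul_mem_fdo h hdet' hγ' with h1 | h1 <;>
        rw [← hγ_eq, h1] <;> simp
  · rintro (rfl | rfl | rfl | rfl)
    · rwa [one_smul]
    · rwa [int_neg_smul, one_smul]
    · exact reflection_smul_mem_fdo h
    · rw [int_neg_smul]
      exact reflection_smul_mem_fdo h

theorem volume_setOf_re_eq (x : ℝ) : volume {z : ℂ | z.re = x} = 0 := by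
  have : {z : ℂ | z.re = x} = Complex.measurableEquivRealProd ⁻¹' ({x} ×ˢ univ) := by
    ext z
    simp
  rw [this, Complex.volume_preserving_equiv_real_prod.measure_preimage_equiv,
    Measure.volume_eq_prod, Measure.prod_prod, Real.volume_singleton, zero_mul]

theorem volume_fd_diff_fdo : volume (𝒟 \ 𝒟ᵒ) = 0 := by
  rw [volume_eq_lintegral]
  apply setLIntegral_measure_zero
  have hsub : (UpperHalfPlane.coe '' (𝒟 \ 𝒟ᵒ)) ⊆
      ({z : ℂ | z.re = 1 / 2} ∪ {z : ℂ | z.re = -(1 / 2)}) ∪ Metric.sphere 0 1 := by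
    rintro _ ⟨τ, ⟨h1, h2⟩, rfl⟩
    by_cases hn : 1 < Complex.normSq (τ : ℂ)
    · have h3 : |τ.re| = 1 / 2 := le_antisymm h1.2 (not_lt.1 fun h => h2 ⟨hn, h⟩)
      exact .inl ((abs_eq (by norm_num)).1 h3)
    · right
      have : Complex.normSq (τ : ℂ) = 1 := le_antisymm (not_lt.1 hn) h1.1
      rw [Complex.normSq_eq_norm_sq, pow_eq_one_iff_of_nonneg (norm_nonneg _) two_ne_zero] at this
      simpa using this
  refine measure_mono_null hsub ?_
  simp only [measure_union_null_iff, volume_setOf_re_eq, Measure.addHaar_sphere, and_self]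

theorem tsum_indicator_fdo_smul :
    ∀ᵐ τ : ℍ, ∑' γ : GL (Fin 2) ℤ, 𝒟ᵒ.indicator (1 : ℍ → ℝ≥0∞) (γ • τ) = 4 := by
  have hae : ∀ᵐ τ : ℍ, ∀ γ : GL (Fin 2) ℤ, γ • τ ∉ 𝒟 \ 𝒟ᵒ :=
    ae_all_iff.2 fun γ => measure_eq_zero_iff_ae_notMem.1
      ((measure_preimage_smul volume γ (𝒟 \ 𝒟ᵒ)).trans volume_fd_diff_fdo)
  filter_upwards [hae] with τ hτ
  obtain ⟨g, hg⟩ := ModularGroup.exists_smul_mem_fd τ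
  rw [← coe_smul_eq_smul] at hg
  have hfdo : (g : GL (Fin 2) ℤ) • τ ∈ 𝒟ᵒ := not_not.1 fun h => hτ g ⟨hg, h⟩
  rw [← (Equiv.mulRight (g : GL (Fin 2) ℤ)).tsum_eq]
  have hcoset (γ : GL (Fin 2) ℤ) : 𝒟ᵒ.indicator (1 : ℍ → ℝ≥0∞) ((Equiv.mulRight ↑g γ) • τ)
      = if γ ∈ ({1, -1, reflection, -reflection} : Finset (GL (Fin 2) ℤ)) then 1 else 0 := by
    classical
    rw [Equiv.coe_mulRight, mul_smul, indicator_apply]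
    simp only [smul_mem_fdo_iff hfdo, Pi.one_apply]
  have hcard : ({1, -1, reflection, -reflection} : Finset (GL (Fin 2) ℤ)).card = 4 := by decide
  rw [tsum_congr hcoset, tsum_eq_sum (s := {1, -1, reflection, -reflection})
    (fun γ hγ => if_neg hγ), Finset.sum_congr rfl (fun γ hγ => if_pos hγ), Finset.sum_const, hcard,
    nsmul_one, Nat.cast_ofNat]

theorem card_stabilizer_mul_tsum_orbit_volume (R : ℝ) (f : BinaryCubicForm ℤ) :
    ENat.card (MulAction.stabilizer (GL (Fin 2) ℤ) f) *
      ∑' g : MulAction.orbit (GL (Fin 2) ℤ) f,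
        volume (𝒟ᵒ ∩ lowSet R (g : BinaryCubicForm ℤ).toReal)
      = 4 * volume (lowSet R f.toReal) := by
  rw [card_stabilizer_mul_tsum_orbit f fun g => volume (𝒟ᵒ ∩ lowSet R g.toReal),
    ← tsum_measure_inter_preimage_smul volume ModularGroup.isOpen_fdo.measurableSet
      tsum_indicator_fdo_smul,
    ← ((Equiv.inv (GL (Fin 2) ℤ)).trans twist.toEquiv).tsum_eq fun γ => volume
      (𝒟ᵒ ∩ (γ • ·) ⁻¹' lowSet R f.toReal)]
  refine tsum_congr fun γ => congrArg _ (ext fun τ => and_congr_right fun _ => ?_)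
  change τ ∈ lowSet R (γ • f).toReal ↔ twist γ⁻¹ • τ ∈ lowSet R f.toReal
  rw [← twist_smul_mem_lowSet_iff R (Matrix.GeneralLinearGroup.map (Int.castRingHom ℝ) γ) f.toReal
    (twist γ⁻¹ • τ), ← map_twist, ← toReal_gl_smul, ← int_smul_def, map_inv, smul_inv_smul]

theorem volume_lowSet_eq (R : ℝ) {f g : BinaryCubicForm ℝ} (h : 0 < f.disc * g.disc) :
    volume (lowSet R f) = volume (lowSet R g) := by
  obtain ⟨M, rfl⟩ := exists_gl_smul_eq h
  rw [volume_lowSet_gl_smul]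

theorem volume_ne_zero_of_isOpen {U : Set ℍ} (hU : IsOpen U) (hne : U.Nonempty) :
    volume U ≠ 0 := by
  rw [volume_eq_lintegral]
  refine ((setLIntegral_pos_iff (by fun_prop)).2 ?_).ne'
  have hsub : UpperHalfPlane.coe '' U ⊆ (Function.support fun z : ℂ =>
      (((1 / ‖z.im‖₊) ^ 2 : ℝ≥0) : ℝ≥0∞)) ∩ UpperHalfPlane.coe '' U := by
    refine subset_inter ?_ subset_rfl
    rintro _ ⟨τ, -, rfl⟩
    simpa using τ.im_ne_zero
  exact ((isOpenEmbedding_coe.isOpenMap U hU).measure_pos volume (hne.image _)).trans_le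
    (measure_mono hsub)

theorem I_mem_lowSet {R : ℝ} (hR : R ≠ 0) {w : BinaryCubicForm ℝ} (hw : w ∈ R • unitBall)
    (hdisc : |w.disc| = 1) : I ∈ lowSet R w := by
  obtain ⟨b, hb, rfl⟩ := hw
  rw [unitBall, mem_ofPred_eq, Real.sqrt_lt' one_pos, one_pow] at hb
  rw [lowSet, mem_ofPred_eq, height_I, hdisc, Real.sqrt_one, q_smul]
  exact mul_lt_mul_of_pos_left hb (by positivity)

end BinaryCubicForm

/-! ### The algorithm for fixed `t` and `s` -/

namespace CubicSampling

open BinaryCubicForm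

theorem uniformBelow_apply {l k : ℕ} (hk : k < l) : uniformBelow l k = (l : ℝ≥0∞)⁻¹ := by
  have hl : l ≠ 0 := by lia
  rw [uniformBelow, dif_neg hl, PMF.uniformOfFinset_apply_of_mem _ (Finset.mem_range.2 hk),
    Finset.card_range]

theorem coin_apply_true {p : ℝ≥0} (hp : p ≤ 1) : coin p true = p := by
  simp [coin, hp]

section SamplePoint

variable {n : ℕ} (x : Fin n → ℝ) (l : Fin n → ℕ) (M : Matrix (Fin n) (Fin n) ℝ)

/-- The least value that `samplePoint` can give to the `i`-th coordinate when the preceding ones are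
those of `v`. -/
noncomputable def sampleBase (v : Fin n → ℤ) (i : Fin n) : ℤ :=
  ⌈x i - ∑ j with j < i, M⁻¹ i j * v j⌉

/-- One step of `samplePoint`: the choice of the `i`-th coordinate. -/
noncomputable def sampleStep (v : Fin n → ℤ) (i : Fin n) : PMF (Fin n → ℤ) :=
  (uniformBelow (l i)).bind fun δ => PMF.pure (Function.update v i (sampleBase x M v i + δ))

theorem samplePoint_eq_foldlM :
    samplePoint x l M = (List.finRange n).foldlM (m := PMF) (sampleStep x l M) 0 := rfl

theorem foldlM_sampleStep_cons_apply (i : Fin n) (L : List (Fin n)) (w v : Fin n → ℤ) :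
    (i :: L).foldlM (m := PMF) (sampleStep x l M) w v
      = ∑' δ : ℕ, uniformBelow (l i) δ *
        L.foldlM (m := PMF) (sampleStep x l M)
          (Function.update w i (sampleBase x M w i + δ)) v := by
  rw [List.foldlM_cons]
  change (sampleStep x l M w i).bind (L.foldlM (m := PMF) (sampleStep x l M)) v = _
  simp only [sampleStep, PMF.bind_bind, PMF.pure_bind, PMF.bind_apply]

theorem foldlM_sampleStep_apply_eq_zero {L : List (Fin n)} {i : Fin n} (hi : i ∉ L)
    {w v : Fin n → ℤ} (hne : w i ≠ v i) :
    L.foldlM (m := PMF) (sampleStep x l M) w v = 0 := by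
  induction L generalizing w with
  | nil => exact PMF.pure_apply_of_ne _ _ fun h => hne (congrFun h.symm i)
  | cons j L ih =>
    rw [List.mem_cons, not_or] at hi
    rw [foldlM_sampleStep_cons_apply, ENNReal.tsum_eq_zero]
    intro δ
    rw [ih hi.2 (by rwa [Function.update_of_ne hi.1]), mul_zero]

theorem foldlM_sampleStep_apply {v : Fin n → ℤ}
    (hv : ∀ i, v i ∈ Ico (sampleBase x M v i) (sampleBase x M v i + l i))
    {L : List (Fin n)} (hL : L.Pairwise (· < ·)) {w : Fin n → ℤ} (hw : ∀ j ∉ L, w j = v j) :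
    L.foldlM (m := PMF) (sampleStep x l M) w v = (L.map fun i => (l i : ℝ≥0∞)⁻¹).prod := by
  induction L generalizing w with
  | nil =>
    obtain rfl : w = v := funext fun j => hw j List.not_mem_nil
    exact PMF.pure_apply_self w
  | cons i L ih =>
    rw [List.pairwise_cons] at hL
    have hiL : i ∉ L := fun h => lt_irrefl i (hL.1 i h)
    have hbase : sampleBase x M w i = sampleBase x M v i := by
      refine congrArg (fun y => ⌈x i - y⌉) (Finset.sum_congr rfl fun j hj => ?_)
      have hji : j < i := (Finset.mem_filter.1 hj).2
      rw [hw j]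
      rw [List.mem_cons, not_or]
      exact ⟨hji.ne, fun h => (hL.1 j h).not_gt hji⟩
    obtain ⟨h1, h2⟩ := hv i
    obtain ⟨k, hk⟩ := Int.eq_ofNat_of_zero_le (sub_nonneg.2 h1)
    rw [foldlM_sampleStep_cons_apply, hbase, tsum_eq_single k]
    · rw [uniformBelow_apply (by lia), List.map_cons, List.prod_cons, ih hL.2]
      intro j hj
      by_cases hji : j = i
      · rw [hji, Function.update_self]
        lia
      · rw [Function.update_of_ne hji, hw j (by simp [hji, hj])]
    · intro δ hδ
      rw [foldlM_sampleStep_apply_eq_zero x l M hiL, mul_zero]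
      rw [Function.update_self]
      lia

theorem samplePoint_apply {v : Fin n → ℤ}
    (hv : ∀ i, v i ∈ Ico (sampleBase x M v i) (sampleBase x M v i + l i)) :
    samplePoint x l M v = ∏ i, (l i : ℝ≥0∞)⁻¹ := by
  rw [samplePoint_eq_foldlM, foldlM_sampleStep_apply x l M hv (List.pairwise_lt_finRange n)
    fun j hj => absurd (List.mem_finRange j) hj, ← List.ofFn_eq_map, List.prod_ofFn]

end SamplePoint

/-- The conditions under which the algorithm returns `f` in its final step. -/
def IsAccepted (r : ℕ) (R T t s : ℝ) (f : BinaryCubicForm ℤ) : Prop :=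
  f.toReal ∈ signatureSet r ∧ (0 < |f.toReal.disc| ∧ |f.toReal.disc| ≤ T) ∧
    f.IrreducibleOverRat ∧
    f.toReal ∈ (R * |f.toReal.disc| ^ (1 / 4 : ℝ)) • (nMat t * aMat s) • unitBall

/-- The probability with which a draw of `s` survives the third step of the algorithm. -/
noncomputable def acceptanceRate (lam s : ℝ) : ℝ≥0 :=
  ((∏ i, (intSide lam s i : ℝ)) / ∏ i, boundSide lam i).toNNReal

/-- The random lattice point of the fourth step of the algorithm. -/
noncomputable def sampleCoeffs (lam t s : ℝ) : PMF (Fin 4 → ℤ) :=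
  samplePoint (fun i => -(1 / 2) * (intSide lam s i : ℝ)) (intSide lam s) (nAct t)

open Classical in
theorem runAt_eq (r : ℕ) (R T t s : ℝ) :
    runAt r R T t s =
      if (1 - t ^ 2) ^ (1 / 4 : ℝ) < s ∧ s < sMax (R * T ^ (1 / 4 : ℝ)) then
        (coin (acceptanceRate (R * T ^ (1 / 4 : ℝ)) s)).bind fun go =>
          if go = true then
            (sampleCoeffs (R * T ^ (1 / 4 : ℝ)) t s).bind fun v =>
              if IsAccepted r R T t s (ofCoeffs v) then PMF.pure (some (ofCoeffs v))
              else PMF.pure none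
          else PMF.pure none
      else PMF.pure none := by
  unfold runAt acceptanceRate IsAccepted
  congr!

open Classical in
theorem runAt_apply_some (r : ℕ) (R T t s : ℝ) (f : BinaryCubicForm ℤ) :
    runAt r R T t s (some f) =
      if ((1 - t ^ 2) ^ (1 / 4 : ℝ) < s ∧ s < sMax (R * T ^ (1 / 4 : ℝ)))
          ∧ IsAccepted r R T t s f then
        coin (acceptanceRate (R * T ^ (1 / 4 : ℝ)) s) true
          * sampleCoeffs (R * T ^ (1 / 4 : ℝ)) t s f.coeffs
      else 0 := by
  have hnone : (PMF.pure none : PMF (Option (BinaryCubicForm ℤ))) (some f) = 0 := by simp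
  have htest (v : Fin 4 → ℤ) : (if IsAccepted r R T t s (ofCoeffs v) then
        PMF.pure (some (ofCoeffs v)) else PMF.pure none : PMF (Option (BinaryCubicForm ℤ))) (some f)
      = if v = f.coeffs then (if IsAccepted r R T t s f then 1 else 0) else 0 := by
    by_cases hv : v = f.coeffs
    · rw [if_pos hv, hv]
      change (if IsAccepted r R T t s f then PMF.pure (some f) else PMF.pure none :
        PMF (Option (BinaryCubicForm ℤ))) (some f) = _
      split_ifs <;> simp
    · have hne : f ≠ ofCoeffs v := by
        rintro rfl
        exact hv (by ext i; fin_cases i <;> rfl)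
      split_ifs <;> simp [hne]
  rw [runAt_eq]
  split_ifs with h1 h2 h2
  · simp only [PMF.bind_apply, tsum_bool, if_true, Bool.false_eq_true, if_false, htest, hnone]
    simp [h2.2]
  · have h3 : ¬IsAccepted r R T t s f := fun h3 => h2 ⟨h1, h3⟩
    simp only [PMF.bind_apply, tsum_bool, if_true, Bool.false_eq_true, if_false, htest, hnone]
    simp [h3]
  · exact absurd h2.1 h1
  · exact hnone

end CubicSampling

namespace CubicSampling

open BinaryCubicForm UpperHalfPlane Modular

theorem nAct_mul_nAct_neg (t : ℝ) : nAct t * nAct (-t) = 1 := by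
  ext i j
  fin_cases i <;> fin_cases j <;>
    simp [nAct, Matrix.mul_apply, Fin.sum_univ_four] <;> ring

theorem nAct_inv (t : ℝ) : (nAct t)⁻¹ = nAct (-t) :=
  Matrix.inv_eq_right_inv (nAct_mul_nAct_neg t)

theorem nAct_inv_mulVec_nMat_smul_coeffs (t : ℝ) (g : BinaryCubicForm ℝ) :
    (nAct t)⁻¹.mulVec (nMat t • g).coeffs = g.coeffs := by
  rw [coeffs_nMat_smul, Matrix.mulVec_mulVec, Matrix.nonsing_inv_mul, Matrix.one_mulVec]
  exact Matrix.isUnit_det_of_right_inverse (nAct_mul_nAct_neg t)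

theorem nAct_inv_mulVec (t : ℝ) (v : Fin 4 → ℝ) (i : Fin 4) :
    ((nAct t)⁻¹.mulVec v) i = ∑ j with j < i, (nAct t)⁻¹ i j * v j + v i := by
  rw [nAct_inv]
  fin_cases i <;>
    simp [nAct, Matrix.mulVec, dotProduct, Fin.sum_univ_four, Finset.sum_filter]

theorem aMat_smul {s : ℝ} (hs : s ≠ 0) (g : BinaryCubicForm ℝ) :
    aMat s • g = ⟨(s ^ 3)⁻¹ * g.a, s⁻¹ * g.b, s * g.c, s ^ 3 * g.d⟩ := by
  have hval : (aMat s).val = !![s⁻¹, 0; 0, s] := by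
    rw [aMat, dif_pos hs]
    rfl
  rw [gl_smul_eq_iff, hval, Matrix.det_fin_two]
  ext <;> simp [subst, BinaryCubicForm.smul_def] <;> field_simp

theorem abs_coeff_lt_of_q_lt {g : BinaryCubicForm ℝ} {lam : ℝ} (hlam : 0 ≤ lam)
    (h : q g < lam ^ 2) :
    |g.a| < lam / 2 ∧ |g.b| < √5 * lam / 2 ∧ |g.c| < √5 * lam / 2 ∧ |g.d| < lam / 2 := by
  have h5 : √5 ^ 2 = 5 := Real.sq_sqrt (by norm_num)
  rw [q] at h
  refine ⟨?_, ?_, ?_, ?_⟩ <;>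
    refine abs_lt_of_sq_lt_sq ?_ (by positivity) <;> rw [div_pow] <;> try rw [mul_pow, h5]
  · nlinarith [sq_nonneg (g.a + g.c), sq_nonneg (g.b + g.d), sq_nonneg g.d]
  · nlinarith [sq_nonneg (g.a + g.c), sq_nonneg (5 * g.d + g.b), sq_nonneg g.a]
  · nlinarith [sq_nonneg (g.b + g.d), sq_nonneg (5 * g.a + g.c), sq_nonneg g.d]
  · nlinarith [sq_nonneg (g.a + g.c), sq_nonneg (g.b + g.d), sq_nonneg g.a]

theorem abs_nAct_inv_mulVec_lt {f : BinaryCubicForm ℝ} {t s lam : ℝ} (hs : 0 < s) (hlam : 0 ≤ lam)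
    (h : f.height (point t s hs) < lam ^ 2) (i : Fin 4) :
    |((nAct t)⁻¹.mulVec f.coeffs) i| < side lam s i / 2 := by
  obtain ⟨g, rfl⟩ : ∃ g, f = (nMat t * aMat s) • g := ⟨_, (smul_inv_smul _ f).symm⟩
  rw [height_point, inv_smul_smul] at h
  rw [mul_smul, nAct_inv_mulVec_nMat_smul_coeffs, aMat_smul hs.ne']
  obtain ⟨ha, hb, hc, hd⟩ := abs_coeff_lt_of_q_lt hlam h
  have hmul {x y k : ℝ} (hk : 0 < k) (hxy : |x| < y / 2) : |k * x| < y * k / 2 := by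
    rw [abs_mul, abs_of_pos hk, mul_comm, mul_div_right_comm]
    exact mul_lt_mul_of_pos_right hxy hk
  fin_cases i
  · exact hmul (by positivity) ha
  · exact hmul (by positivity) hb
  · exact hmul hs hc
  · exact hmul (by positivity) hd

theorem sMin_pos : 0 < sMin := by
  rw [sMin]
  positivity

theorem sMin_pow_four : sMin ^ 4 = 3 / 4 := by
  rw [sMin, show (4 : ℕ) = 2 * 2 from rfl, pow_mul, Real.sq_sqrt (by positivity), div_pow,
    Real.sq_sqrt (by norm_num)]
  norm_num

section Sides

variable {lam s : ℝ}

theorem sMax_pow_three (hlam : 0 ≤ lam) : sMax lam ^ 3 = lam / 2 := by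
  rw [sMax, ← Real.rpow_natCast, ← Real.rpow_mul (by positivity)]
  norm_num

theorem sMax_pos (hlam : 0 < lam) : 0 < sMax lam := by
  rw [sMax]
  positivity

theorem prod_boundSide_pos (hlam : 0 < lam) : 0 < ∏ i, boundSide lam i := by
  have := sMin_pos
  have := sMax_pos hlam
  simp only [Fin.prod_univ_four, boundSide, Matrix.cons_val]
  positivity

theorem side_pos (hlam : 0 < lam) (hs : 0 < s) (i : Fin 4) : 0 < side lam s i := by
  unfold side
  match i with
  | 0 | 1 | 2 | 3 => simp only [Matrix.cons_val]; positivity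

theorem side_le_intSide (lam s : ℝ) (i : Fin 4) : side lam s i ≤ intSide lam s i := by
  have := Nat.lt_floor_add_one (1 + side lam s i)
  rw [intSide]
  linarith

theorem prod_intSide_pos (hlam : 0 < lam) (hs : 0 < s) : 0 < ∏ i, (intSide lam s i : ℝ) :=
  Finset.prod_pos fun i _ => (side_pos hlam hs i).trans_le (side_le_intSide lam s i)

theorem prod_intSide_le (hlam : 0 < lam) (hs : sMin < s) (hs' : s < sMax lam) :
    ∏ i, (intSide lam s i : ℝ) ≤ ∏ i, boundSide lam i := by
  have hm := sMin_pos
  have hs0 : 0 < s := hm.trans hs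
  have hfloor (i : Fin 4) : (intSide lam s i : ℝ) ≤ 1 + side lam s i :=
    Nat.floor_le (by linarith [side_pos hlam hs0 i])
  calc ∏ i, (intSide lam s i : ℝ) ≤ ∏ i, (1 + side lam s i) :=
        Finset.prod_le_prod (fun i _ => by positivity) fun i _ => hfloor i
    _ = (s ^ 3 + lam) * (s + √5 * lam) * (s⁻¹ + √5 * lam) * ((s ^ 3)⁻¹ + lam) := by
        simp only [Fin.prod_univ_four, side, Matrix.cons_val]
        field_simp
    _ ≤ ∏ i, boundSide lam i := by
        have := sMax_pos hlam
        simp only [Fin.prod_univ_four, boundSide, Matrix.cons_val]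
        gcongr

end Sides

/-- The probability with which each target form `f` is returned when `t + i s²` lies in
`𝒟ᵒ ∩ lowSet R f`: the reciprocal of `L₁' L₂' L₃' L₄'`. -/
noncomputable def weight (lam : ℝ) : ℝ≥0∞ := (ENNReal.ofReal (∏ i, boundSide lam i))⁻¹

theorem coin_acceptanceRate_mul_prod_inv_intSide {lam s : ℝ} (hlam : 0 < lam) (hs : sMin < s)
    (hs' : s < sMax lam) :
    coin (acceptanceRate lam s) true * ∏ i, (intSide lam s i : ℝ≥0∞)⁻¹ = weight lam := by
  have hI := prod_intSide_pos hlam (sMin_pos.trans hs)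
  have hB := prod_boundSide_pos hlam
  have hprod : ∏ i, (intSide lam s i : ℝ≥0∞)⁻¹
      = (ENNReal.ofReal (∏ i, (intSide lam s i : ℝ)))⁻¹ := by
    rw [ENNReal.ofReal_prod_of_nonneg fun i _ => by positivity,
      ENNReal.prod_inv_distrib (by simp [Set.Pairwise])]
    simp only [ENNReal.ofReal_natCast]
  rw [coin_apply_true, acceptanceRate, hprod, ← ENNReal.ofReal, ENNReal.ofReal_div_of_pos hB,
    div_eq_mul_inv, mul_right_comm, ENNReal.mul_inv_cancel (by simpa using hI)
    ENNReal.ofReal_ne_top, one_mul, weight]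
  exact Real.toNNReal_le_one.2 ((div_le_one hB).2 (prod_intSide_le hlam hs hs'))

theorem lt_sMax_of_height_lt {f : BinaryCubicForm ℤ} {t s lam : ℝ} (hs : 0 < s) (hlam : 0 < lam)
    (h : f.toReal.height (point t s hs) < lam ^ 2) (ha : f.a ≠ 0) : s < sMax lam := by
  have hlt := abs_nAct_inv_mulVec_lt hs hlam.le h 0
  have hcoeff : ((nAct t)⁻¹.mulVec f.toReal.coeffs) 0 = (f.a : ℝ) := by
    rw [nAct_inv_mulVec]
    simp [coeffs, toReal, BinaryCubicForm.map]
  have hone : (1 : ℝ) ≤ |(f.a : ℝ)| := mod_cast Int.one_le_abs ha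
  rw [hcoeff, side, Matrix.cons_val_zero] at hlt
  have hlt' := hone.trans_lt hlt
  rw [lt_div_iff₀ two_pos, lt_mul_inv_iff₀ (by positivity)] at hlt'
  apply lt_of_pow_lt_pow_left₀ 3 (sMax_pos hlam).le
  rw [sMax_pow_three hlam.le]
  linarith

theorem sampleCoeffs_apply {f : BinaryCubicForm ℤ} {t s lam : ℝ} (hs : 0 < s) (hlam : 0 ≤ lam)
    (h : f.toReal.height (point t s hs) < lam ^ 2) :
    sampleCoeffs lam t s f.coeffs = ∏ i, (intSide lam s i : ℝ≥0∞)⁻¹ := by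
  refine samplePoint_apply _ _ _ fun i => ?_
  have hbox := abs_lt.1 (abs_nAct_inv_mulVec_lt hs hlam h i)
  have hle := side_le_intSide lam s i
  have hcast (j : Fin 4) : f.toReal.coeffs j = (f.coeffs j : ℝ) := by
    fin_cases j <;> rfl
  simp only [nAct_inv_mulVec, hcast] at hbox
  constructor
  · rw [sampleBase, Int.ceil_le]
    linarith
  · rw [sampleBase, ← sub_lt_iff_lt_add, Int.lt_ceil]
    push_cast
    linarith

theorem sq_mul_rpow (R : ℝ) {x : ℝ} (hx : 0 ≤ x) :
    (R * x ^ (1 / 4 : ℝ)) ^ 2 = R ^ 2 * √x := by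
  rw [mul_pow, ← Real.rpow_natCast (_ ^ _), ← Real.rpow_mul hx, Real.sqrt_eq_rpow]
  norm_num

theorem isAccepted_iff (r : ℕ) {R : ℝ} (hR : 0 < R) (T t : ℝ) {s : ℝ} (hs : 0 < s)
    (f : BinaryCubicForm ℤ) :
    IsAccepted r R T t s f ↔ IsTarget r T f ∧ point t s hs ∈ lowSet R f.toReal := by
  have hlow (h : 0 < |f.toReal.disc|) :
      f.toReal ∈ (R * |f.toReal.disc| ^ (1 / 4 : ℝ)) • (nMat t * aMat s) • unitBall
        ↔ point t s hs ∈ lowSet R f.toReal := by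
    rw [mem_smul_unitBall_iff _ (by positivity) t hs, sq_mul_rpow R (abs_nonneg _)]
    rfl
  constructor
  · rintro ⟨hsign, hdisc, hirr, hmem⟩
    exact ⟨⟨hirr, hsign, hdisc⟩, (hlow hdisc.1).1 hmem⟩
  · rintro ⟨⟨hirr, hsign, hdisc⟩, hmem⟩
    exact ⟨hsign, hdisc, hirr, (hlow hdisc.1).2 hmem⟩

theorem mem_fdo_iff {t s : ℝ} (hs : 0 < s) (ht : t ∈ Ioo (-1 / 2 : ℝ) (1 / 2)) :
    point t s hs ∈ 𝒟ᵒ ↔ (1 - t ^ 2) ^ (1 / 4 : ℝ) < s := by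
  have hre : |(point t s hs).re| < 1 / 2 := abs_lt.2 ⟨(neg_div 2 (1 : ℝ)).symm.trans_lt ht.1, ht.2⟩
  have hnorm : Complex.normSq (point t s hs : ℂ) = t ^ 2 + s ^ 4 := by
    change Complex.normSq ⟨t, s ^ 2⟩ = _
    rw [Complex.normSq_mk]
    ring
  have h0 : 0 ≤ 1 - t ^ 2 := by nlinarith [ht.1, ht.2]
  have hpow : (1 - t ^ 2) ^ (1 / 4 : ℝ) < s ↔ 1 - t ^ 2 < s ^ 4 := by
    rw [one_div, Real.rpow_inv_lt_iff_of_pos h0 hs.le (by norm_num)]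
    norm_cast
  rw [hpow, sub_lt_iff_lt_add', ← hnorm]
  exact ⟨fun h => h.1, fun h => ⟨h, hre⟩⟩

open Classical in
theorem runAt_apply_some_eq {r : ℕ} {R T t s : ℝ} (hR : 0 < R) (hT : 0 < T)
    (ht : t ∈ Ioo (-1 / 2 : ℝ) (1 / 2)) (hs : sMin < s) (f : BinaryCubicForm ℤ) :
    runAt r R T t s (some f) =
      if IsTarget r T f ∧ point t s (sMin_pos.trans hs) ∈ 𝒟ᵒ ∩ lowSet R f.toReal then
        weight (R * T ^ (1 / 4 : ℝ))
      else 0 := by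
  have hs0 := sMin_pos.trans hs
  have hlam : 0 < R * T ^ (1 / 4 : ℝ) := by positivity
  have hheight (h : IsTarget r T f ∧ point t s hs0 ∈ lowSet R f.toReal) :
      f.toReal.height (point t s hs0) < (R * T ^ (1 / 4 : ℝ)) ^ 2 := by
    rw [sq_mul_rpow R hT.le]
    exact (show _ < _ from h.2).trans_le (by gcongr; exact h.1.2.2.2)
  simp only [runAt_apply_some, isAccepted_iff r hR T t hs0, ← mem_fdo_iff hs0 ht]
  split_ifs with h h' h'
  · rw [sampleCoeffs_apply hs0 hlam.le (hheight h.2),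
      coin_acceptanceRate_mul_prod_inv_intSide hlam hs h.1.2]
  · exact absurd ⟨h.2.1, h.1.1, h.2.2⟩ h'
  · have hlow := hheight ⟨h'.1, h'.2.2⟩
    exact absurd ⟨⟨h'.2.1, lt_sMax_of_height_lt hs0 hlam hlow h'.1.1.a_ne_zero⟩, h'.1, h'.2.2⟩ h
  · rfl

end CubicSampling

/-! ### Hyperbolic area and the law of `(t, s)` -/

namespace CubicSampling

open BinaryCubicForm UpperHalfPlane Modular

theorem sMeasure_apply {B : Set ℝ} (hB : MeasurableSet B) (hsub : B ⊆ Ioi sMin) :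
    sMeasure B = ∫⁻ s in B, ENNReal.ofReal ((s ^ 3)⁻¹) := by
  rw [sMeasure, withDensity_apply _ hB, Measure.restrict_restrict hB, inter_eq_left.2 hsub]

theorem sMeasure_Ioi : sMeasure (Ioi sMin) = sMeasure univ := by
  rw [sMeasure, withDensity_apply _ measurableSet_Ioi, withDensity_apply _ MeasurableSet.univ,
    Measure.restrict_restrict measurableSet_Ioi, inter_self, Measure.restrict_univ]

theorem sMeasure_univ_ne_zero : sMeasure univ ≠ 0 := by
  rw [← sMeasure_Ioi, sMeasure_apply measurableSet_Ioi subset_rfl]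
  refine ((setLIntegral_pos_iff (by fun_prop)).2 ?_).ne'
  have hsupp : Ioi sMin ⊆ Function.support fun s : ℝ => ENNReal.ofReal ((s ^ 3)⁻¹) := by
    intro s hs
    have hs0 : 0 < s := sMin_pos.trans hs
    rw [Function.mem_support, Ne, ENNReal.ofReal_eq_zero, not_le]
    positivity
  rw [inter_eq_right.2 hsupp, Real.volume_Ioi]
  exact ENNReal.zero_lt_top

theorem sMeasure_univ_ne_top : sMeasure univ ≠ ∞ := by
  have hint := integrableOn_Ioi_rpow_of_lt (a := -3) (by norm_num) sMin_pos
  rw [← sMeasure_Ioi, sMeasure_apply measurableSet_Ioi subset_rfl]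
  refine ne_of_lt (lt_of_eq_of_lt ?_ hint.lintegral_lt_top)
  refine setLIntegral_congr_fun measurableSet_Ioi fun s hs => ?_
  have hs0 : 0 < s := sMin_pos.trans hs
  rw [Real.rpow_neg hs0.le]
  norm_cast

instance : IsProbabilityMeasure sLaw :=
  ⟨by rw [sLaw, Measure.smul_apply, smul_eq_mul,
    ENNReal.inv_mul_cancel sMeasure_univ_ne_zero sMeasure_univ_ne_top]⟩

theorem tLaw_eq : tLaw = volume.restrict (Ioo (-1 / 2) (1 / 2)) := by
  rw [tLaw, ProbabilityTheory.cond, Real.volume_Ioo]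
  norm_num

instance : IsProbabilityMeasure tLaw := ⟨by rw [tLaw_eq]; norm_num⟩

theorem ae_mem_domain :
    ∀ᵐ p ∂(tLaw.prod sLaw), p ∈ Ioo (-1 / 2 : ℝ) (1 / 2) ×ˢ Ioi sMin := by
  have hs : sLaw (Ioi sMin) = 1 := by
    rw [← measure_univ (μ := sLaw), sLaw, Measure.smul_apply, Measure.smul_apply, sMeasure_Ioi]
  have ht : tLaw (Ioo (-1 / 2) (1 / 2)) = 1 := by
    rw [tLaw_eq]
    norm_num
  have hmeas : MeasurableSet (Ioo (-1 / 2 : ℝ) (1 / 2) ×ˢ Ioi sMin) :=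
    measurableSet_Ioo.prod measurableSet_Ioi
  exact (mem_ae_iff_prob_eq_one hmeas).2 (by rw [Measure.prod_prod, hs, ht, one_mul])

/-- The pairs `(t, s)` with `s > 0` for which `t + i s²` lies in `A`. -/
def pairs (A : Set ℍ) : Set (ℝ × ℝ) := {p | ∃ hs : 0 < p.2, point p.1 p.2 hs ∈ A}

theorem measurableSet_pairs {A : Set ℍ} (hA : MeasurableSet A) : MeasurableSet (pairs A) := by
  have hcoe {t s : ℝ} (hs : 0 < s) : (t : ℂ) + (s : ℂ) ^ 2 * Complex.I = point t s hs := by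
    apply Complex.ext <;> simp [point, ← Complex.ofReal_pow]
  have heq : pairs A = {p : ℝ × ℝ | 0 < p.2} ∩
      (fun p : ℝ × ℝ => ((p.1 : ℂ) + (p.2 : ℂ) ^ 2 * Complex.I)) ⁻¹' (UpperHalfPlane.coe '' A) := by
    ext p
    constructor
    · rintro ⟨hs, h⟩
      exact ⟨hs, _, h, (hcoe hs).symm⟩
    · rintro ⟨hs, τ, hτ, h⟩
      refine ⟨hs, ?_⟩
      rwa [← UpperHalfPlane.ext (h.trans (hcoe hs))]
  rw [heq]
  refine (measurableSet_lt measurable_const measurable_snd).inter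
    ((measurableEmbedding_coe.measurableSet_image.2 hA).preimage ?_)
  fun_prop

theorem measurableSet_pairs_fiber {A : Set ℍ} (hA : MeasurableSet A) (t : ℝ) :
    MeasurableSet (Prod.mk t ⁻¹' pairs A) :=
  (measurableSet_pairs hA).preimage measurable_prodMk_left

theorem pairs_fiber_subset_Ioi (A : Set ℍ) (t : ℝ) : Prod.mk t ⁻¹' pairs A ⊆ Ioi 0 :=
  fun _ hs => hs.1

theorem setOf_mk_mem_coe_image (A : Set ℍ) (t : ℝ) :
    {y : ℝ | (⟨t, y⟩ : ℂ) ∈ UpperHalfPlane.coe '' A} = (· ^ 2) '' (Prod.mk t ⁻¹' pairs A) := by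
  ext y
  constructor
  · rintro ⟨τ, hτ, h⟩
    have hre : τ.re = t := congrArg Complex.re h
    have him : τ.im = y := congrArg Complex.im h
    have hy : 0 < y := him ▸ τ.im_pos
    have hsq : √y ^ 2 = y := Real.sq_sqrt hy.le
    have hpoint : point t √y (Real.sqrt_pos.2 hy) = τ :=
      UpperHalfPlane.ext_re_im hre.symm (hsq.trans him.symm)
    exact ⟨√y, ⟨Real.sqrt_pos.2 hy, by rwa [hpoint]⟩, hsq⟩
  · rintro ⟨s, ⟨hs, h⟩, rfl⟩
    exact ⟨_, h, rfl⟩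

theorem volume_eq_lintegral_lintegral {A : Set ℍ} (hA : MeasurableSet A) :
    volume A = ∫⁻ x : ℝ, ∫⁻ y in {y : ℝ | (⟨x, y⟩ : ℂ) ∈ UpperHalfPlane.coe '' A},
      (((1 / ‖y‖₊) ^ 2 : ℝ≥0) : ℝ≥0∞) := by
  have himage := measurableEmbedding_coe.measurableSet_image.2 hA
  have hmeas : Measurable fun p : ℝ × ℝ => (UpperHalfPlane.coe '' A).indicator
      (fun z : ℂ => (((1 / ‖z.im‖₊) ^ 2 : ℝ≥0) : ℝ≥0∞)) (Complex.measurableEquivRealProd.symm p) :=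
    (Measurable.indicator (by fun_prop) himage).comp
      Complex.measurableEquivRealProd.symm.measurable
  rw [volume_eq_lintegral, ← lintegral_indicator himage,
    ← Complex.volume_preserving_equiv_real_prod.symm.lintegral_comp_emb
      Complex.measurableEquivRealProd.symm.measurableEmbedding, Measure.volume_eq_prod,
    lintegral_prod _ hmeas.aemeasurable]
  refine lintegral_congr fun x => ?_
  rw [← lintegral_indicator]
  · rfl
  · exact himage.preimage (Complex.measurableEquivRealProd.symm.measurable.comp
      measurable_prodMk_left)

theorem lintegral_image_sq {B : Set ℝ} (hB : MeasurableSet B) (hpos : B ⊆ Ioi 0) :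
    ∫⁻ y in (· ^ 2) '' B, (((1 / ‖y‖₊) ^ 2 : ℝ≥0) : ℝ≥0∞)
      = 2 * ∫⁻ s in B, ENNReal.ofReal ((s ^ 3)⁻¹) := by
  have hinj : InjOn (fun s : ℝ => s ^ 2) B := fun s hs s' hs' h =>
    (pow_left_inj₀ (hpos hs).le (hpos hs').le two_ne_zero).1 h
  rw [lintegral_image_eq_lintegral_abs_deriv_mul (f' := fun s => 2 * s) hB
    (fun s _ => by simpa using (hasDerivAt_pow 2 s).hasDerivWithinAt) hinj,
    ← lintegral_const_mul' _ _ ENNReal.ofNat_ne_top]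
  refine setLIntegral_congr_fun hB fun s hs => ?_
  have hs0 : 0 < s := hpos hs
  rw [← ENNReal.ofReal_coe_nnreal, ← ENNReal.ofReal_mul (abs_nonneg _),
    ← ENNReal.ofReal_ofNat 2, ← ENNReal.ofReal_mul two_pos.le, abs_of_pos (by positivity)]
  congr 1
  push_cast
  rw [Real.norm_of_nonneg (by positivity)]
  field_simp

theorem volume_eq_lintegral_pairs {A : Set ℍ} (hA : MeasurableSet A) :
    volume A = 2 * ∫⁻ t : ℝ, ∫⁻ s in Prod.mk t ⁻¹' pairs A, ENNReal.ofReal ((s ^ 3)⁻¹) := by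
  rw [volume_eq_lintegral_lintegral hA, ← lintegral_const_mul' _ _ ENNReal.ofNat_ne_top]
  refine lintegral_congr fun t => ?_
  rw [setOf_mk_mem_coe_image,
    lintegral_image_sq (measurableSet_pairs_fiber hA t) (pairs_fiber_subset_Ioi A t)]

theorem mem_domain_of_mem_pairs {A : Set ℍ} (hfdo : A ⊆ 𝒟ᵒ) {p : ℝ × ℝ} (hp : p ∈ pairs A) :
    p ∈ Ioo (-1 / 2 : ℝ) (1 / 2) ×ˢ Ioi sMin := by
  obtain ⟨hs, h⟩ := hp
  have hre : |p.1| < 1 / 2 := (hfdo h).2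
  have him : 3 < 4 * (p.2 ^ 2) ^ 2 := ModularGroup.three_lt_four_mul_im_sq_of_mem_fdo (hfdo h)
  rw [abs_lt, ← neg_div] at hre
  refine ⟨hre, lt_of_pow_lt_pow_left₀ 4 hs.le ?_⟩
  rw [sMin_pow_four]
  linarith

theorem prod_law_pairs {A : Set ℍ} (hA : MeasurableSet A) (hfdo : A ⊆ 𝒟ᵒ) :
    (tLaw.prod sLaw) (pairs A) = (2 * sMeasure univ)⁻¹ * volume A := by
  have hfiber (t : ℝ) : sLaw (Prod.mk t ⁻¹' pairs A) = (sMeasure univ)⁻¹ *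
      ∫⁻ s in Prod.mk t ⁻¹' pairs A, ENNReal.ofReal ((s ^ 3)⁻¹) := by
    rw [sLaw, Measure.smul_apply, smul_eq_mul, sMeasure_apply (measurableSet_pairs_fiber hA t)
      fun s hs => (mem_domain_of_mem_pairs hfdo hs).2]
  have hsupp : (Function.support fun t => sLaw (Prod.mk t ⁻¹' pairs A)) ⊆ Ioo (-1 / 2) (1 / 2) := by
    intro t ht
    obtain ⟨s, hs⟩ := nonempty_of_measure_ne_zero ht
    exact (mem_domain_of_mem_pairs hfdo hs).1
  rw [Measure.prod_apply (measurableSet_pairs hA), tLaw_eq, setLIntegral_eq_of_support_subset hsupp]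
  simp only [hfiber]
  rw [lintegral_const_mul' _ _ (ENNReal.inv_ne_top.2 sMeasure_univ_ne_zero),
    volume_eq_lintegral_pairs hA, ENNReal.mul_inv (by simp) (by simp), mul_comm (2 : ℝ≥0∞)⁻¹,
    mul_assoc, ← mul_assoc (2 : ℝ≥0∞)⁻¹,
    ENNReal.inv_mul_cancel two_ne_zero ENNReal.ofNat_ne_top, one_mul]

end CubicSampling

/-! ### The law of the output -/

theorem measurable_pmf_apply_none {α X : Type*} [MeasurableSpace X] [Countable α]
    {P : X → PMF (Option α)} (hP : ∀ a, Measurable fun x => P x (some a)) :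
    Measurable fun x => P x none := by
  have heq (x : X) : P x none = 1 - ∑' a, P x (some a) := by
    have hsum : P x none + ∑' a, P x (some a) = 1 := by
      rw [← (P x).tsum_coe, ← (Equiv.optionEquivSumPUnit.{0} α).symm.tsum_eq,
        ENNReal.summable.tsum_sum ENNReal.summable, add_comm]
      simp [tsum_fintype]
    exact ENNReal.eq_sub_of_add_eq (ne_top_of_le_ne_top ENNReal.one_ne_top
      (hsum ▸ le_add_self)) hsum
  simp only [heq]
  exact measurable_const.sub (Measurable.tsum hP)

theorem measurable_toMeasure_of_option {α X : Type*} [MeasurableSpace X] [Countable α]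
    [MeasurableSpace (Option α)] [DiscreteMeasurableSpace (Option α)] {P : X → PMF (Option α)}
    (hP : ∀ a, Measurable fun x => P x (some a)) : Measurable fun x => (P x).toMeasure := by
  refine Measure.measurable_of_measurable_coe _ fun A hA => ?_
  simp only [PMF.toMeasure_apply _ hA]
  refine Measurable.tsum fun o => ?_
  by_cases ho : o ∈ A
  · simp only [indicator_of_mem ho]
    cases o with
    | none => exact measurable_pmf_apply_none hP
    | some a => exact hP a
  · simp only [indicator_of_notMem ho]
    exact measurable_const

theorem BinaryCubicForm.IsTarget.disc_ne_zero {r : ℕ} {T : ℝ} {f : BinaryCubicForm ℤ}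
    (hf : f.IsTarget r T) : f.disc ≠ 0 := fun h =>
  abs_pos.1 hf.2.2.1 (by rw [toReal, disc_map, h, map_zero])

namespace CubicSampling

open BinaryCubicForm UpperHalfPlane Modular

instance : Countable (BinaryCubicForm ℤ) :=
  Function.Injective.countable (f := BinaryCubicForm.coeffs) fun _ _ h =>
    BinaryCubicForm.ext (congrFun h 0) (congrFun h 1) (congrFun h 2) (congrFun h 3)

theorem runAt_apply_some_eq_indicator {r : ℕ} {R T : ℝ} (hR : 0 < R) (hT : 0 < T)
    {p : ℝ × ℝ} (hp : p ∈ Ioo (-1 / 2 : ℝ) (1 / 2) ×ˢ Ioi sMin) {f : BinaryCubicForm ℤ}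
    (hf : IsTarget r T f) :
    runAt r R T p.1 p.2 (some f)
      = (pairs (𝒟ᵒ ∩ lowSet R f.toReal)).indicator (fun _ => weight (R * T ^ (1 / 4 : ℝ))) p := by
  classical
  rw [runAt_apply_some_eq hR hT hp.1 hp.2, indicator_apply]
  simp only [hf, true_and]
  exact if_congr ⟨fun h => ⟨sMin_pos.trans hp.2, h⟩, fun h => h.2⟩ rfl rfl

theorem runAt_apply_some_eq_zero {r : ℕ} {R T : ℝ} (t s : ℝ) {f : BinaryCubicForm ℤ}
    (hf : ¬IsTarget r T f) : runAt r R T t s (some f) = 0 := by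
  classical
  rw [runAt_apply_some, if_neg fun h => hf ⟨h.2.2.2.1, h.2.1, h.2.2.1⟩]

theorem isTarget_of_mem_support {r : ℕ} {R T t s : ℝ} {f : BinaryCubicForm ℤ}
    (h : some f ∈ (runAt r R T t s).support) : IsTarget r T f := by
  by_contra hf
  exact h (runAt_apply_some_eq_zero t s hf)

theorem measurableSet_fdo_inter_lowSet (R : ℝ) (f : BinaryCubicForm ℝ) :
    MeasurableSet (𝒟ᵒ ∩ lowSet R f) :=
  (ModularGroup.isOpen_fdo.inter (isOpen_lowSet R f)).measurableSet

theorem aemeasurable_runAt (r : ℕ) {R T : ℝ} (hR : 0 < R) (hT : 0 < T) :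
    AEMeasurable (fun p : ℝ × ℝ => (runAt r R T p.1 p.2).toMeasure) (tLaw.prod sLaw) := by
  classical
  set E : Set (ℝ × ℝ) := Ioo (-1 / 2) (1 / 2) ×ˢ Ioi sMin
  let P : ℝ × ℝ → PMF (Option (BinaryCubicForm ℤ)) := fun p =>
    if p ∈ E then runAt r R T p.1 p.2 else PMF.pure none
  have hP (f : BinaryCubicForm ℤ) : (fun p => P p (some f))
      = E.indicator fun p => runAt r R T p.1 p.2 (some f) := by
    ext p
    by_cases hp : p ∈ E <;> simp [P, hp]
  refine ⟨fun p => (P p).toMeasure, measurable_toMeasure_of_option fun f => ?_, ?_⟩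
  · rw [hP]
    by_cases hf : IsTarget r T f
    · rw [indicator_congr fun p hp => runAt_apply_some_eq_indicator hR hT hp hf]
      exact (measurable_const.indicator (measurableSet_pairs
        (measurableSet_fdo_inter_lowSet R _))).indicator (measurableSet_Ioo.prod measurableSet_Ioi)
    · simp only [runAt_apply_some_eq_zero _ _ hf, indicator_zero, measurable_const]
  · filter_upwards [ae_mem_domain] with p hp
    simp only [P, if_pos (show p ∈ E from hp)]

theorem outputLaw_apply (r : ℕ) {R T : ℝ} (hR : 0 < R) (hT : 0 < T)
    (A : Set (Option (BinaryCubicForm ℤ))) :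
    outputLaw r R T A = ∫⁻ p, (runAt r R T p.1 p.2).toMeasure A ∂(tLaw.prod sLaw) :=
  Measure.bind_apply trivial (aemeasurable_runAt r hR hT)

theorem isProbabilityMeasure_outputLaw (r : ℕ) {R T : ℝ} (hR : 0 < R) (hT : 0 < T) :
    IsProbabilityMeasure (outputLaw r R T) :=
  ⟨by simp [outputLaw_apply r hR hT]⟩

/-- The ratio between the probability that the algorithm returns a given target form `f` and the
hyperbolic area of `𝒟ᵒ ∩ lowSet R f`. -/
noncomputable def returnRate (R T : ℝ) : ℝ≥0∞ :=
  weight (R * T ^ (1 / 4 : ℝ)) * (2 * sMeasure univ)⁻¹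

theorem returnRate_ne_zero (R T : ℝ) : returnRate R T ≠ 0 :=
  mul_ne_zero (ENNReal.inv_ne_zero.2 ENNReal.ofReal_ne_top)
    (ENNReal.inv_ne_zero.2 (ENNReal.mul_ne_top ENNReal.ofNat_ne_top sMeasure_univ_ne_top))

theorem outputLaw_singleton {r : ℕ} {R T : ℝ} (hR : 0 < R) (hT : 0 < T) {f : BinaryCubicForm ℤ}
    (hf : IsTarget r T f) :
    outputLaw r R T {some f} = returnRate R T * volume (𝒟ᵒ ∩ lowSet R f.toReal) := by
  have hmeas := measurableSet_fdo_inter_lowSet R f.toReal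
  calc outputLaw r R T {some f}
      = ∫⁻ p, runAt r R T p.1 p.2 (some f) ∂(tLaw.prod sLaw) := by
        simp only [outputLaw_apply r hR hT,
          PMF.toMeasure_apply_singleton _ _ (measurableSet_singleton _)]
    _ = ∫⁻ p, (pairs (𝒟ᵒ ∩ lowSet R f.toReal)).indicator
          (fun _ => weight (R * T ^ (1 / 4 : ℝ))) p ∂(tLaw.prod sLaw) := by
        refine lintegral_congr_ae ?_
        filter_upwards [ae_mem_domain] with p hp
        exact runAt_apply_some_eq_indicator hR hT hp hf
    _ = returnRate R T * volume (𝒟ᵒ ∩ lowSet R f.toReal) := by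
        rw [lintegral_indicator_const (measurableSet_pairs hmeas),
          prod_law_pairs hmeas inter_subset_left, returnRate, mul_assoc]

theorem outputLaw_image_some {r : ℕ} {R T : ℝ} (hR : 0 < R) (hT : 0 < T)
    {O : Set (BinaryCubicForm ℤ)} (hO : ∀ f ∈ O, IsTarget r T f) :
    outputLaw r R T (some '' O)
      = returnRate R T * ∑' f : O, volume (𝒟ᵒ ∩ lowSet R (f : BinaryCubicForm ℤ).toReal) := by
  rw [← ENNReal.tsum_mul_left, ← biUnion_of_singleton (some '' O), biUnion_image,
    measure_biUnion (to_countable O)]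
  · exact tsum_congr fun f => outputLaw_singleton hR hT (hO f f.2)
  · intro f _ g _ hfg
    simpa using hfg
  · exact fun _ _ => measurableSet_singleton _

theorem outputLaw_image_some_le_success (r : ℕ) (R T : ℝ) (O : Set (BinaryCubicForm ℤ)) :
    outputLaw r R T (some '' O) ≤ outputLaw r R T {o | o ≠ none} := by
  refine measure_mono ?_
  rintro _ ⟨f, -, rfl⟩
  exact Option.some_ne_none f

theorem outputLaw_orbit {r : ℕ} {R T : ℝ} (hR : 0 < R) (hT : 0 < T)
    {f : BinaryCubicForm ℤ} (hf : IsTarget r T f) :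
    outputLaw r R T (some '' MulAction.orbit (GL (Fin 2) ℤ) f)
      * Nat.card (MulAction.stabilizer (GL (Fin 2) ℤ) f)
      = returnRate R T * (4 * volume (lowSet R f.toReal)) := by
  have := (finite_stabilizer_and_card_le hf.disc_ne_zero).1
  rw [outputLaw_image_some hR hT, ← card_stabilizer_mul_tsum_orbit_volume,
    ENat.card_eq_coe_natCard, ENat.toENNReal_coe]
  · ring
  · rintro _ ⟨γ, rfl⟩
    exact (isTarget_gl_smul_iff r T γ f).2 hf

end CubicSampling

/-! ### Lattice points and the success probability -/

theorem exists_finset_modEq_abs_sub_lt {N : ℕ} (hN : 0 < N) {ρ : ℝ} (hρ : N ≤ ρ) (c : ℤ) (w : ℝ) :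
    ∃ F : Finset ℤ, ρ / N ≤ F.card ∧ ∀ u ∈ F, u ≡ c [ZMOD N] ∧ |u - w| < ρ := by
  have hN' : (0 : ℝ) < N := by exact_mod_cast hN
  set x := (w - ρ - c) / N
  set y := (w + ρ - c) / N
  refine ⟨(Finset.Ioo ⌊x⌋ ⌈y⌉).image fun k => c + N * k, ?_, ?_⟩
  · rw [Finset.card_image_of_injective _ fun k l h => by simpa [hN.ne'] using h, Int.card_Ioo]
    have hxy : y - x = 2 * (ρ / N) := by simp only [x, y]; field_simp; ring
    have hone : 1 ≤ ρ / N := (one_le_div hN').2 hρ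
    calc ρ / N ≤ ⌈y⌉ - ⌊x⌋ - 1 := by linarith [Int.le_ceil y, Int.floor_le x]
      _ ≤ ((⌈y⌉ - ⌊x⌋ - 1).toNat : ℝ) := by exact_mod_cast Int.self_le_toNat _
  · intro u hu
    obtain ⟨k, hk, rfl⟩ := Finset.mem_image.1 hu
    rw [Finset.mem_Ioo, Int.floor_lt, Int.lt_ceil, div_lt_iff₀ hN', lt_div_iff₀ hN'] at hk
    refine ⟨by simp [Int.ModEq], ?_⟩
    push_cast
    rw [abs_lt]
    constructor <;> linarith [hk.1, hk.2]

theorem exists_finset_pi_modEq_abs_sub_lt {ι : Type*} [Fintype ι] {N : ℕ} (hN : 0 < N) {ρ : ℝ}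
    (hρ : N ≤ ρ) (c : ι → ℤ) (w : ι → ℝ) :
    ∃ F : Finset (ι → ℤ), (ρ / N) ^ Fintype.card ι ≤ F.card ∧
      ∀ u ∈ F, ∀ i, u i ≡ c i [ZMOD N] ∧ |u i - w i| < ρ := by
  classical
  choose F hcard hF using fun i => exists_finset_modEq_abs_sub_lt hN hρ (c i) (w i)
  refine ⟨Fintype.piFinset F, ?_, fun u hu i => hF i _ (Fintype.mem_piFinset.1 hu i)⟩
  have hρ' : 0 ≤ ρ / N := div_nonneg (N.cast_nonneg.trans hρ) N.cast_nonneg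
  rw [Fintype.card_piFinset, ← Finset.card_univ, ← Finset.prod_const]
  push_cast
  exact Finset.prod_le_prod (fun _ _ => hρ') fun i _ => hcard i

namespace BinaryCubicForm

open CubicSampling UpperHalfPlane Modular

theorem ofCoeffs_injective {A : Type*} : Function.Injective (ofCoeffs (A := A)) := by
  intro u v h
  rw [BinaryCubicForm.ext_iff] at h
  ext i
  fin_cases i
  exacts [h.1, h.2.1, h.2.2.1, h.2.2.2]

theorem disc_ne_zero_of_mem_unitDiscSet {r : ℕ} {w : BinaryCubicForm ℝ} (hw : w ∈ unitDiscSet r) :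
    w.disc ≠ 0 :=
  abs_pos.1 (hw.2 ▸ one_pos)

theorem disc_mul_disc_pos {r : ℕ} (hr : r = 1 ∨ r = 3) {f g : BinaryCubicForm ℝ}
    (hf : f ∈ signatureSet r) (hg : g ∈ signatureSet r) (hf0 : f.disc ≠ 0) (hg0 : g.disc ≠ 0) :
    0 < f.disc * g.disc := by
  have h := mul_pos ((mem_signatureSet_iff hr hf0).1 hf) ((mem_signatureSet_iff hr hg0).1 hg)
  have hsq : discSign r * discSign r = 1 := by
    rw [discSign]
    split_ifs <;> norm_num
  rwa [mul_mul_mul_comm, hsq, one_mul] at h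

theorem volume_lowSet_toReal_eq {r : ℕ} (hr : r = 1 ∨ r = 3) (R : ℝ) {T : ℝ}
    {w : BinaryCubicForm ℝ} (hw : w ∈ unitDiscSet r) {f : BinaryCubicForm ℤ}
    (hf : f.IsTarget r T) : volume (lowSet R f.toReal) = volume (lowSet R w) :=
  volume_lowSet_eq R (disc_mul_disc_pos hr hf.2.1 hw.1 (abs_pos.1 hf.2.2.1)
    (disc_ne_zero_of_mem_unitDiscSet hw))

theorem volume_lowSet_ne_zero {R : ℝ} (hR : R ≠ 0) {r : ℕ} {w : BinaryCubicForm ℝ}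
    (hw : w ∈ R • unitBall ∩ unitDiscSet r) : volume (lowSet R w) ≠ 0 :=
  volume_ne_zero_of_isOpen (isOpen_lowSet R w) ⟨I, I_mem_lowSet hR hw.1 hw.2.2⟩

theorem exists_mem_unitDiscSet_mem_lowSet {R : ℝ} (hR : R ≠ 0) {r : ℕ} {w : BinaryCubicForm ℝ}
    (hw : w ∈ R • unitBall ∩ unitDiscSet r) (τ : ℍ) :
    ∃ f ∈ unitDiscSet r, τ ∈ lowSet R f := by
  set g := nMat τ.re * aMat √τ.im
  refine ⟨g • w, ⟨(gl_smul_mem_signatureSet_iff g w r).2 hw.2.1, ?_⟩, ?_⟩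
  · rw [disc_gl_smul, det_nMat_mul_aMat _ (Real.sqrt_pos.2 τ.im_pos), one_pow, one_mul, hw.2.2]
  · rw [← twist_frame_smul_I τ]
    exact (twist_smul_mem_lowSet_iff R g w I).2 (I_mem_lowSet hR hw.1 hw.2.2)

/-- The coefficient vectors of the real forms with `r` real roots and `|disc| < 2` whose low set
contains `U`. Integral points of a dilate of such a window are target forms once they are
irreducible. -/
def window (r : ℕ) (R : ℝ) (U : Set ℍ) : Set (Fin 4 → ℝ) :=
  {v | 0 < discSign r * (ofCoeffs v).disc ∧ |(ofCoeffs v).disc| < 2 ∧ U ⊆ lowSet R (ofCoeffs v)}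

theorem exists_ball_subset_window {r : ℕ} (hr : r = 1 ∨ r = 3) {R : ℝ} {f : BinaryCubicForm ℝ}
    (hf : f ∈ unitDiscSet r) {V : Set ℍ} (hV : IsOpen V) {τ : ℍ} (hτV : τ ∈ V)
    (hτ : τ ∈ lowSet R f) :
    ∃ U ⊆ V, IsOpen U ∧ U.Nonempty ∧ ∃ w : Fin 4 → ℝ, ∃ ε > 0, Metric.ball w ε ⊆ window r R U := by
  let O : Set ((Fin 4 → ℝ) × ℍ) := {p | 0 < discSign r * (ofCoeffs p.1).disc ∧
    |(ofCoeffs p.1).disc| < 2 ∧ p.2 ∈ lowSet R (ofCoeffs p.1) ∧ p.2 ∈ V}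
  have hdisc : Continuous fun p : (Fin 4 → ℝ) × ℍ => (ofCoeffs p.1).disc := by
    unfold disc ofCoeffs
    fun_prop
  have hO : IsOpen O := (isOpen_lt continuous_const (continuous_const.mul hdisc)).inter
    ((isOpen_lt hdisc.abs continuous_const).inter
      ((isOpen_lt continuous_height_ofCoeffs (continuous_const.mul hdisc.abs.sqrt)).inter
        (hV.preimage continuous_snd)))
  have hmem : (f.coeffs, τ) ∈ O :=
    ⟨(mem_signatureSet_iff hr (disc_ne_zero_of_mem_unitDiscSet hf)).1 hf.1,
      hf.2.trans_lt one_lt_two, hτ, hτV⟩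
  obtain ⟨W, U, hW, hU, hfW, hτU, hWU⟩ := isOpen_prod_iff.1 hO _ _ hmem
  obtain ⟨ε, hε, hball⟩ := Metric.isOpen_iff.1 hW _ hfW
  refine ⟨U, fun σ hσ => (hWU (mk_mem_prod hfW hσ)).2.2.2, hU, ⟨τ, hτU⟩, f.coeffs, ε, hε,
    fun v hv => ?_⟩
  have hv (σ : ℍ) (hσ : σ ∈ U) : (v, σ) ∈ O := hWU (mk_mem_prod (hball hv) hσ)
  exact ⟨(hv τ hτU).1, (hv τ hτU).2.1, fun σ hσ => (hv σ hσ).2.2.1⟩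

-- `X³ + XY² + Y³` is irreducible modulo `2`.
theorem irreducibleOverRat_ofCoeffs {u : Fin 4 → ℤ} (hu : ∀ i, u i ≡ ![1, 0, 1, 1] i [ZMOD 2]) :
    (ofCoeffs u).IrreducibleOverRat :=
  irreducibleOverRat_of_odd (Int.odd_iff.2 (hu 0)) (Int.odd_iff.2 (hu 3))
    (Int.odd_iff.2 ((hu 1).add (hu 2)))

theorem isTarget_and_subset_lowSet_of_mem_window {r : ℕ} (hr : r = 1 ∨ r = 3) {R T κ : ℝ}
    (hκ : 0 < κ) (hκT : κ ^ 4 = T / 2) {U : Set ℍ} {u : Fin 4 → ℤ}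
    (hirr : (ofCoeffs u).IrreducibleOverRat) (hu : (fun i => κ⁻¹ * (u i : ℝ)) ∈ window r R U) :
    (ofCoeffs u).IsTarget r T ∧ U ⊆ lowSet R (ofCoeffs u).toReal := by
  set v : Fin 4 → ℝ := fun i => κ⁻¹ * u i
  obtain ⟨hsign, hlt, hU⟩ := hu
  have hreal : (ofCoeffs u).toReal = κ • ofCoeffs v := by
    ext <;> exact (mul_inv_cancel_left₀ hκ.ne' _).symm
  have hdisc : (ofCoeffs u).toReal.disc = κ ^ 4 * (ofCoeffs v).disc := by rw [hreal, disc_smul]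
  have hne : (ofCoeffs u).toReal.disc ≠ 0 := by
    rw [hdisc]
    exact mul_ne_zero (by positivity) (right_ne_zero_of_mul hsign.ne')
  refine ⟨⟨hirr, ?_, abs_pos.2 hne, ?_⟩, ?_⟩
  · rw [mem_signatureSet_iff hr hne, hdisc, mul_left_comm]
    positivity
  · rw [hdisc, abs_mul, abs_of_pos (by positivity)]
    nlinarith [pow_pos hκ 4]
  · rwa [hreal, lowSet_smul R hκ.ne']

theorem exists_finset_isTarget {r : ℕ} (hr : r = 1 ∨ r = 3) {R T : ℝ} {U : Set ℍ}
    {w : Fin 4 → ℝ} {ε : ℝ} (hε : 0 < ε) (hball : Metric.ball w ε ⊆ window r R U)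
    (hT : 32 ≤ T * ε ^ 4) :
    ∃ F : Finset (BinaryCubicForm ℤ), T * ε ^ 4 / 32 ≤ F.card ∧
      ∀ f ∈ F, f.IsTarget r T ∧ U ⊆ lowSet R f.toReal := by
  classical
  have hT0 : 0 < T := pos_of_mul_pos_left (by linarith : 0 < T * ε ^ 4) (by positivity)
  obtain ⟨κ, hκ, hκT⟩ : ∃ κ : ℝ, 0 < κ ∧ κ ^ 4 = T / 2 :=
    ⟨(T / 2) ^ (1 / 4 : ℝ), by positivity, by
      rw [← Real.rpow_natCast, ← Real.rpow_mul (by positivity)]; norm_num⟩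
  have hκε : ((2 : ℕ) : ℝ) ≤ κ * ε := by
    refine le_of_pow_le_pow_left₀ four_ne_zero (by positivity) ?_
    rw [mul_pow, hκT]
    norm_num
    linarith
  obtain ⟨F, hcard, hF⟩ :=
    exists_finset_pi_modEq_abs_sub_lt two_pos hκε ![1, 0, 1, 1] fun i => κ * w i
  refine ⟨F.image ofCoeffs, ?_, ?_⟩
  · rw [Finset.card_image_of_injective _ ofCoeffs_injective]
    calc T * ε ^ 4 / 32 = (κ * ε / (2 : ℕ)) ^ Fintype.card (Fin 4) := by
          rw [Fintype.card_fin, div_pow, mul_pow, hκT]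
          norm_num
          ring
      _ ≤ F.card := hcard
  · intro f hf
    obtain ⟨u, hu, rfl⟩ := Finset.mem_image.1 hf
    refine isTarget_and_subset_lowSet_of_mem_window hr hκ hκT
      (irreducibleOverRat_ofCoeffs fun i => (hF u hu i).1) (hball ?_)
    rw [Metric.mem_ball, dist_pi_lt_iff hε]
    intro i
    rw [Real.dist_eq, ← inv_mul_cancel_left₀ hκ.ne' (w i), ← mul_sub, abs_mul,
      abs_of_pos (inv_pos.2 hκ), inv_mul_lt_iff₀ hκ]
    exact (hF u hu i).2

end BinaryCubicForm

namespace CubicSampling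

open BinaryCubicForm UpperHalfPlane Modular

theorem prod_boundSide_mono {lam lam' : ℝ} (hlam : 0 < lam) (h : lam ≤ lam') :
    ∏ i, boundSide lam i ≤ ∏ i, boundSide lam' i := by
  have hs : sMax lam ≤ sMax lam' := by
    unfold sMax
    gcongr
  have hlam' := hlam.trans_le h
  have := sMax_pos hlam
  have := sMax_pos hlam'
  have := sMin_pos
  simp only [Fin.prod_univ_four, boundSide, Matrix.cons_val]
  gcongr

theorem sMax_le_self {lam : ℝ} (hlam : 1 ≤ lam) : sMax lam ≤ lam := by
  refine le_of_pow_le_pow_left₀ three_ne_zero (by positivity) ?_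
  rw [sMax_pow_three (by positivity)]
  linarith [le_self_pow₀ hlam three_ne_zero]

theorem sMin_inv_le_two : sMin⁻¹ ≤ 2 := by
  refine inv_le_of_inv_le₀ two_pos (le_of_pow_le_pow_left₀ four_ne_zero sMin_pos.le ?_)
  rw [sMin_pow_four]
  norm_num

theorem prod_boundSide_le {lam : ℝ} (hlam : 1 ≤ lam) : ∏ i, boundSide lam i ≤ 360 * lam ^ 4 := by
  have h0 : 0 < lam := by linarith
  have := sMax_pos h0
  have := sMin_pos
  have hsMax := sMax_le_self hlam
  have hsMin := sMin_inv_le_two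
  have hsMin3 : (sMin ^ 3)⁻¹ ≤ 2 ^ 3 := by
    rw [← inv_pow]
    gcongr
  have hsqrt : √5 * lam ≤ 3 * lam := by
    gcongr
    exact Real.sqrt_le_iff.2 (by norm_num)
  calc ∏ i, boundSide lam i
      = (sMax lam ^ 3 + lam) * (sMax lam + √5 * lam) * (sMin⁻¹ + √5 * lam)
        * ((sMin ^ 3)⁻¹ + lam) := by simp only [Fin.prod_univ_four, boundSide, Matrix.cons_val]
    _ ≤ (2 * lam) * (4 * lam) * (5 * lam) * (9 * lam) := by
        rw [sMax_pow_three h0.le]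
        gcongr <;> linarith
    _ = 360 * lam ^ 4 := by ring

theorem inv_le_weight {lam : ℝ} (hlam : 1 ≤ lam) :
    (ENNReal.ofReal (360 * lam ^ 4))⁻¹ ≤ weight lam :=
  ENNReal.inv_le_inv.2 (ENNReal.ofReal_le_ofReal (prod_boundSide_le hlam))

theorem returnRate_anti {R T T' : ℝ} (hR : 0 < R) (hT : 0 < T) (h : T ≤ T') :
    returnRate R T' ≤ returnRate R T := by
  refine mul_le_mul_left (ENNReal.inv_le_inv.2 (ENNReal.ofReal_le_ofReal
    (prod_boundSide_mono (by positivity) ?_))) _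
  gcongr

theorem mul_rpow_pow_four (R : ℝ) {T : ℝ} (hT : 0 ≤ T) :
    (R * T ^ (1 / 4 : ℝ)) ^ 4 = R ^ 4 * T := by
  rw [mul_pow, ← Real.rpow_natCast (T ^ _), ← Real.rpow_mul hT]
  norm_num

theorem exists_le_success_of_le {r : ℕ} (hr : r = 1 ∨ r = 3) {R : ℝ} (hR : 0 < R)
    (hU : (R • unitBall ∩ unitDiscSet r).Nonempty) (T₀ : ℝ) :
    ∃ x : ℝ≥0∞, x ≠ 0 ∧ ∀ T, 0 < T → T ≤ T₀ → (∃ f, IsTarget r T f) →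
      x ≤ outputLaw r R T {o | o ≠ none} := by
  obtain ⟨w, hw⟩ := hU
  have hne : returnRate R T₀ * (4 * volume (lowSet R w)) ≠ 0 := mul_ne_zero
    (returnRate_ne_zero R T₀) (mul_ne_zero four_ne_zero (volume_lowSet_ne_zero hR.ne' hw))
  refine ⟨returnRate R T₀ * (4 * volume (lowSet R w)) / 6,
    ENNReal.div_ne_zero.2 ⟨hne, ENNReal.ofNat_ne_top⟩, ?_⟩
  rintro T hT hTT₀ ⟨f, hf⟩
  refine ENNReal.div_le_of_le_mul ?_
  calc returnRate R T₀ * (4 * volume (lowSet R w))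
      ≤ returnRate R T * (4 * volume (lowSet R f.toReal)) := by
        rw [volume_lowSet_toReal_eq hr R hw.2 hf]
        gcongr
        exact returnRate_anti hR hT hTT₀
    _ = outputLaw r R T (some '' MulAction.orbit (GL (Fin 2) ℤ) f)
          * Nat.card (MulAction.stabilizer (GL (Fin 2) ℤ) f) := (outputLaw_orbit hR hT hf).symm
    _ ≤ outputLaw r R T {o | o ≠ none} * 6 :=
        mul_le_mul' (outputLaw_image_some_le_success r R T _)
          (by exact_mod_cast (finite_stabilizer_and_card_le hf.disc_ne_zero).2)

theorem le_success_of_forall_isTarget {r : ℕ} {R T : ℝ} (hR : 0 < R) (hT : 0 < T) {U : Set ℍ}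
    (hU : U ⊆ 𝒟ᵒ) {F : Finset (BinaryCubicForm ℤ)}
    (hF : ∀ f ∈ F, f.IsTarget r T ∧ U ⊆ lowSet R f.toReal) :
    returnRate R T * (F.card * volume U) ≤ outputLaw r R T {o | o ≠ none} := by
  refine le_trans ?_ (outputLaw_image_some_le_success r R T F)
  rw [outputLaw_image_some hR hT fun f hf => (hF f hf).1,
    F.tsum_subtype' fun f => volume (𝒟ᵒ ∩ lowSet R f.toReal), ← nsmul_eq_mul]
  gcongr
  exact Finset.card_nsmul_le_sum _ _ _ fun f hf => measure_mono (subset_inter hU (hF f hf).2)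

theorem le_success_of_ball_subset_window {r : ℕ} (hr : r = 1 ∨ r = 3) {R T : ℝ} (hR : 0 < R)
    (hRT : 1 ≤ R ^ 4 * T) {U : Set ℍ} (hU : U ⊆ 𝒟ᵒ) {w : Fin 4 → ℝ} {ε : ℝ} (hε : 0 < ε)
    (hball : Metric.ball w ε ⊆ window r R U) (hT : 32 ≤ T * ε ^ 4) :
    ENNReal.ofReal (ε ^ 4 / (32 * (360 * R ^ 4))) * (2 * sMeasure univ)⁻¹ * volume U
      ≤ outputLaw r R T {o | o ≠ none} := by
  have hT0 : 0 < T := pos_of_mul_pos_right (one_pos.trans_le hRT) (by positivity)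
  have hlam : 1 ≤ R * T ^ (1 / 4 : ℝ) := by
    refine le_of_pow_le_pow_left₀ four_ne_zero (by positivity) ?_
    rwa [one_pow, mul_rpow_pow_four R hT0.le]
  obtain ⟨F, hcard, hF⟩ := exists_finset_isTarget hr hε hball hT
  have hweight : ENNReal.ofReal (ε ^ 4 / (32 * (360 * R ^ 4)))
      ≤ weight (R * T ^ (1 / 4 : ℝ)) * F.card := by
    calc ENNReal.ofReal (ε ^ 4 / (32 * (360 * R ^ 4)))
        = (ENNReal.ofReal (360 * (R * T ^ (1 / 4 : ℝ)) ^ 4))⁻¹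
            * ENNReal.ofReal (T * ε ^ 4 / 32) := by
          rw [mul_rpow_pow_four R hT0.le, ← ENNReal.ofReal_inv_of_pos (by positivity),
            ← ENNReal.ofReal_mul (by positivity)]
          congr 1
          field_simp
      _ ≤ weight (R * T ^ (1 / 4 : ℝ)) * F.card := by
          gcongr
          · exact inv_le_weight hlam
          · exact ENNReal.ofReal_le_of_le_toReal hcard
  calc ENNReal.ofReal (ε ^ 4 / (32 * (360 * R ^ 4))) * (2 * sMeasure univ)⁻¹ * volume U
      ≤ weight (R * T ^ (1 / 4 : ℝ)) * F.card * (2 * sMeasure univ)⁻¹ * volume U := by gcongr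
    _ = returnRate R T * (F.card * volume U) := by rw [returnRate]; ring
    _ ≤ outputLaw r R T {o | o ≠ none} := le_success_of_forall_isTarget hR hT0 hU hF

theorem exists_le_success_of_ge {r : ℕ} (hr : r = 1 ∨ r = 3) {R : ℝ} (hR : 0 < R)
    (hU : (R • unitBall ∩ unitDiscSet r).Nonempty) :
    ∃ T₀ : ℝ, ∃ x : ℝ≥0∞, x ≠ 0 ∧ ∀ T ≥ T₀, x ≤ outputLaw r R T {o | o ≠ none} := by
  obtain ⟨w₀, hw₀⟩ := hU
  have hτ : point 0 2 two_pos ∈ 𝒟ᵒ := by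
    rw [mem_fdo_iff two_pos (by norm_num)]
    norm_num
  obtain ⟨f, hf, hfτ⟩ := exists_mem_unitDiscSet_mem_lowSet hR.ne' hw₀ (point 0 2 two_pos)
  obtain ⟨U, hUfdo, hUo, hUne, w, ε, hε, hball⟩ :=
    exists_ball_subset_window hr hf ModularGroup.isOpen_fdo hτ hfτ
  refine ⟨max (1 / R ^ 4) (32 / ε ^ 4),
    ENNReal.ofReal (ε ^ 4 / (32 * (360 * R ^ 4))) * (2 * sMeasure univ)⁻¹ * volume U, ?_,
    fun T hT => le_success_of_ball_subset_window hr hR ?_ hUfdo hε hball ?_⟩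
  · refine mul_ne_zero (mul_ne_zero ?_ (ENNReal.inv_ne_zero.2
      (ENNReal.mul_ne_top ENNReal.ofNat_ne_top sMeasure_univ_ne_top)))
      (volume_ne_zero_of_isOpen hUo hUne)
    exact (ENNReal.ofReal_pos.2 (by positivity)).ne'
  · exact (div_le_iff₀' (by positivity)).1 ((le_max_left _ _).trans hT)
  · exact (div_le_iff₀ (by positivity)).1 ((le_max_right _ _).trans hT)

theorem exists_success_bound {r : ℕ} (hr : r = 1 ∨ r = 3) {R : ℝ} (hR : 0 < R)
    (hU : (R • unitBall ∩ unitDiscSet r).Nonempty) :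
    ∃ p₀ : ℝ, 0 < p₀ ∧ ∀ T : ℝ, 0 < T → (∃ f : BinaryCubicForm ℤ, IsTarget r T f) →
      p₀ < (outputLaw r R T).real {o | o ≠ none} := by
  obtain ⟨T₀, x₂, hx₂, hlarge⟩ := exists_le_success_of_ge hr hR hU
  obtain ⟨x₁, hx₁, hsmall⟩ := exists_le_success_of_le hr hR hU T₀
  obtain ⟨p₀, hp₀, hlt⟩ := ENNReal.lt_iff_exists_nnreal_btwn.1
    (lt_min (pos_iff_ne_zero.2 hx₁) (pos_iff_ne_zero.2 hx₂))
  refine ⟨p₀, by exact_mod_cast hp₀, fun T hT hf => ?_⟩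
  have := isProbabilityMeasure_outputLaw r hR hT
  have hge : min x₁ x₂ ≤ outputLaw r R T {o | o ≠ none} := by
    rcases le_total T T₀ with h | h
    · exact (min_le_left _ _).trans (hsmall T hT h hf)
    · exact (min_le_right _ _).trans (hlarge T h)
  exact (ENNReal.toReal_lt_toReal ENNReal.coe_ne_top (measure_ne_top _ _)).2 (hlt.trans_le hge)

theorem exists_orbit_constant {r : ℕ} (hr : r = 1 ∨ r = 3) {R T : ℝ} (hR : 0 < R) (hT : 0 < T)
    (hU : (R • unitBall ∩ unitDiscSet r).Nonempty) :
    ∃ D : ℝ, 0 < D ∧ ∀ f : BinaryCubicForm ℤ, IsTarget r T f →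
      Finite (MulAction.stabilizer (GL (Fin 2) ℤ) f) ∧
      (outputLaw r R T).real (some '' MulAction.orbit (GL (Fin 2) ℤ) f)
        = D * (1 / (Nat.card (MulAction.stabilizer (GL (Fin 2) ℤ) f) : ℝ)) := by
  obtain ⟨w, hw⟩ := hU
  have := isProbabilityMeasure_outputLaw r hR hT
  by_cases hex : ∃ f : BinaryCubicForm ℤ, IsTarget r T f
  swap
  · exact ⟨1, one_pos, fun f hf => absurd ⟨f, hf⟩ hex⟩
  set x : ℝ≥0∞ := returnRate R T * (4 * volume (lowSet R w))
  have horbit {f : BinaryCubicForm ℤ} (hf : IsTarget r T f) :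
      outputLaw r R T (some '' MulAction.orbit (GL (Fin 2) ℤ) f)
        * Nat.card (MulAction.stabilizer (GL (Fin 2) ℤ) f) = x := by
    rw [outputLaw_orbit hR hT hf, volume_lowSet_toReal_eq hr R hw.2 hf]
  have hx : x ≠ 0 := mul_ne_zero (returnRate_ne_zero R T)
    (mul_ne_zero four_ne_zero (volume_lowSet_ne_zero hR.ne' hw))
  have hx' : x ≠ ∞ := by
    obtain ⟨f, hf⟩ := hex
    rw [← horbit hf]
    exact ENNReal.mul_ne_top (measure_ne_top _ _) (ENNReal.natCast_ne_top _)
  refine ⟨x.toReal, ENNReal.toReal_pos hx hx', fun f hf => ?_⟩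
  have hfin := (finite_stabilizer_and_card_le hf.disc_ne_zero).1
  have hcard : (Nat.card (MulAction.stabilizer (GL (Fin 2) ℤ) f) : ℝ) ≠ 0 :=
    Nat.cast_ne_zero.2 Nat.card_pos.ne'
  refine ⟨hfin, ?_⟩
  rw [mul_one_div, eq_div_iff hcard, ← horbit hf, ENNReal.toReal_mul, ENNReal.toReal_natCast,
    measureReal_def]

end CubicSampling

theorem theorem3 (r : ℕ) (hr : r = 1 ∨ r = 3) (R : ℝ) (hR : 0 < R)
    (hU : (R • BinaryCubicForm.unitBall ∩ BinaryCubicForm.unitDiscSet r).Nonempty) :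
    (∀ T : ℝ, 1 ≤ T →
      IsProbabilityMeasure (CubicSampling.outputLaw r R T) ∧
      (∀ t ∈ Set.Ioo (-1 / 2 : ℝ) (1 / 2), ∀ s ∈ Set.Ioi CubicSampling.sMin,
        ∀ f : BinaryCubicForm ℤ, some f ∈ (CubicSampling.runAt r R T t s).support →
          BinaryCubicForm.IsTarget r T f) ∧
      (∃ D : ℝ, 0 < D ∧ ∀ f : BinaryCubicForm ℤ, BinaryCubicForm.IsTarget r T f →
        Finite (MulAction.stabilizer (Matrix.GeneralLinearGroup (Fin 2) ℤ) f) ∧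
        (CubicSampling.outputLaw r R T).real
            (some '' MulAction.orbit (Matrix.GeneralLinearGroup (Fin 2) ℤ) f)
          = D * (1 / (Nat.card (MulAction.stabilizer (Matrix.GeneralLinearGroup (Fin 2) ℤ) f) : ℝ))))
    ∧ ∃ p₀ : ℝ, 0 < p₀ ∧ ∀ T : ℝ, 1 ≤ T →
      (∃ f : BinaryCubicForm ℤ, BinaryCubicForm.IsTarget r T f) →
        p₀ < (CubicSampling.outputLaw r R T).real {o | o ≠ none} := by
  obtain ⟨p₀, hp₀, hsuccess⟩ := CubicSampling.exists_success_bound hr hR hU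
  refine ⟨fun T hT => ?_, p₀, hp₀, fun T hT => hsuccess T (one_pos.trans_le hT)⟩
  have hT0 : 0 < T := one_pos.trans_le hT
  exact ⟨CubicSampling.isProbabilityMeasure_outputLaw r hR hT0,
    fun t _ s _ f hf => CubicSampling.isTarget_of_mem_support hf,
    CubicSampling.exists_orbit_constant hr hR hT0 hU⟩
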